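/- Let $\mathcal X$ be a measurable space, $\pi$ a probability measure on $\mathcal X$, $T\ge 1$ an integer and $h:\mathcal X^T\to\mathbb R$ a bounded measurable function. Let $P_0=\pi^{\otimes T}$, so that the coordinates $X_1,\dots,X_T$ of $\mathbf X_T$ are i.i.d. with law $\pi$ under $P_0$, and write $E_0,\mathrm{Var}_0$ for expectation and variance under $P_0$; $X,Y$ denote independent random variables with law $\pi$. For a probability measure $P$ on $\mathcal X^2$ with marginals $P_X,P_Y$, let $\phi^2(P)=\int\left(\frac{dP}{d(P_X\times P_Y)}-1\right)^2 d(P_X\times P_Y)$ (and $\phi^2(P)=\infty$ if $P\not\ll P_X\times P_Y$). For $\eta>0$ consider the problems of maximizing and of minimizing $E_f[h(\mathbf X_T)]$ over all probability measures $P_f$ on $\mathcal X^T$ such that: $P_f\ll P_0$; every $X_t$ has law $\pi$ under $P_f$; $(X_t)_{t=1}^T$ is stationary under $P_f$; $(X_t)_{t=1}^T$ is $1$-dependent under $P_f$, i.e. for every $t$, conditionally on $X_t$, $(X_s)_{s<t}$ and $(X_s)_{s>t}$ are independent; and the law of $(X_{t-1},X_t)$ under $P_f$ has $\phi^2$-coefficient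 at most $\eta$ for $t=2,\dots,T$. Put $$H(x,y)=\sum_{t=2}^T E_0[h(\mathbf X_T)\mid X_{t-1}=x,X_t=y],$$ where the conditional expectation is the version obtained by fixing $X_{t-1}=x$, $X_t=y$ and integrating the other coordinates against $\pi$, and $$R(x,y)=H(x,y)-E_0[H(X,Y)\mid X=x]-E_0[H(X,Y)\mid Y=y]+E_0[H(X,Y)].$$ Assume $\mathrm{Var}_0(R(X,Y))>0$. Then for all sufficiently small $\eta>0$ the maximum and the minimum are attained, and as $\eta\downarrow 0$ $$\max E_f[h(\mathbf X_T)]=E_0[h(\mathbf X_T)]+\Xi_1\sqrt\eta+\Xi_2\,\eta+O(\eta^{3/2}),$$ $$\min E_f[h(\mathbf X_T)]=E_0[h(\mathbf X_T)]-\Xi_1\sqrt\eta+\Xi_2\,\eta+O(\eta^{3/2}),$$ where $$\Xi_1=\sqrt{\mathrm{Var}_0(R(X,Y))},\qquad \Xi_2=\frac{\sum_{2\le s<t\le T}E_0\left[R(X_{s-1},X_s)\,R(X_{t-1},X_t)\,h(\mathbf X_T)\right]}{\mathrm{Var}_0(R(X,Y))}.$$ -/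

import Mathlib

open MeasureTheory ProbabilityTheory Filter Asymptotics
open scoped ENNReal Topology

noncomputable section

namespace SerialDependency

variable {𝒳 : Type*} [MeasurableSpace 𝒳]

/-! ### The `χ²`-distance and the `φ²`-coefficient -/

open Classical in
/-- The `χ²`-distance `χ²(P₁, P₂) = E₂[(dP₁/dP₂ - 1)²]`, with the usual convention that it is
infinite if `P₁` is not absolutely continuous with respect to `P₂`. -/
def chiSq {α : Type*} [MeasurableSpace α] (P₁ P₂ : Measure α) : ℝ≥0∞ :=
  if P₁ ≪ P₂ then ∫⁻ a, ENNReal.ofReal (((P₁.rnDeriv P₂ a).toReal - 1) ^ 2) ∂P₂ else ∞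

/-- The `φ²`-coefficient of a bivariate distribution: its `χ²`-distance from the product of its
two marginal distributions. -/
def phiSq (P : Measure (𝒳 × 𝒳)) : ℝ≥0∞ :=
  chiSq P ((P.map Prod.fst).prod (P.map Prod.snd))

/-! ### Processes with a finite time horizon

A process `X₁, …, X_T` with time horizon `T = n + 1` is given by its law, a measure on the path
space `Fin (n + 1) → 𝒳`; `X_t` is the coordinate map. The `n = T - 1` transitions
`(X_{t-1}, X_t)`, `t = 2, …, T`, are indexed by `i : Fin n`, the pair being
`(x i.castSucc, x i.succ)`. -/

/-- The process is stationary: shifting a block of consecutive times does not change its joint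
distribution. -/
def IsStationary {n : ℕ} (P : Measure (Fin (n + 1) → 𝒳)) : Prop :=
  ∀ (m k : ℕ) (hmk : m + k ≤ n + 1),
    P.map (fun x (i : Fin k) => x ⟨m + i, by omega⟩) =
      P.map (fun x (i : Fin k) => x ⟨i, by omega⟩)

/-- The `σ`-algebra generated by the present state `X_t`. -/
abbrev present {n : ℕ} (t : Fin (n + 1)) : MeasurableSpace (Fin (n + 1) → 𝒳) :=
  MeasurableSpace.comap (fun x => x t) inferInstance

/-- The `σ`-algebra generated by the states `X_s`, `s < t`. -/
abbrev past {n : ℕ} (t : Fin (n + 1)) : MeasurableSpace (Fin (n + 1) → 𝒳) :=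
  ⨆ s : {s : Fin (n + 1) // s < t}, present s.1

/-- The `σ`-algebra generated by the states `X_s`, `s > t`. -/
abbrev future {n : ℕ} (t : Fin (n + 1)) : MeasurableSpace (Fin (n + 1) → 𝒳) :=
  ⨆ s : {s : Fin (n + 1) // t < s}, present s.1

/-- The process is `1`-dependent: for every `t`, conditionally on `X_t`, the past
`(X_s)_{s < t}` and the future `(X_s)_{s > t}` are independent. Conditional independence is
written out through conditional probabilities, so that no topological assumption on the state
space is needed. -/
def IsOneDependent {n : ℕ} (P : Measure (Fin (n + 1) → 𝒳)) : Prop :=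
  ∀ (t : Fin (n + 1)) (A B : Set (Fin (n + 1) → 𝒳)),
    MeasurableSet[past t] A → MeasurableSet[future t] B →
      P⟦A ∩ B | present t⟧ =ᵐ[P] P⟦A | present t⟧ * P⟦B | present t⟧

/-- The baseline model: `X₁, …, X_T` are i.i.d. with distribution `π`. -/
def baseline (π : Measure 𝒳) (n : ℕ) : Measure (Fin (n + 1) → 𝒳) :=
  Measure.pi fun _ => π

/-! ### The optimization problems -/

/-- The feasible laws: stationary `1`-dependent processes, absolutely continuous with respect to
the baseline, with the baseline marginal distributions, and with `φ²`-coefficient of consecutive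
states at most `η`. -/
structure Feasible (π : Measure 𝒳) {n : ℕ} (η : ℝ) (P : Measure (Fin (n + 1) → 𝒳)) : Prop where
  isProbabilityMeasure : IsProbabilityMeasure P
  phiSq_le : ∀ i : Fin n,
    phiSq (P.map fun x => (x i.castSucc, x i.succ)) ≤ ENNReal.ofReal η
  isOneDependent : IsOneDependent P
  isStationary : IsStationary P
  marginal : ∀ t : Fin (n + 1), P.map (fun x => x t) = π
  absolutelyContinuous : P ≪ baseline π n

/-- The set of values `E_f[h(X₁, …, X_T)]` over all feasible laws. -/
def objectiveValues (π : Measure 𝒳) {n : ℕ} (h : (Fin (n + 1) → 𝒳) → ℝ) (η : ℝ) : Set ℝ :=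
  {v | ∃ P : Measure (Fin (n + 1) → 𝒳), Feasible π η P ∧ v = ∫ x, h x ∂P}

/-- The optimal value of the maximization problem. -/
def maxValue (π : Measure 𝒳) {n : ℕ} (h : (Fin (n + 1) → 𝒳) → ℝ) (η : ℝ) : ℝ :=
  sSup (objectiveValues π h η)

/-- The optimal value of the minimization problem. -/
def minValue (π : Measure 𝒳) {n : ℕ} (h : (Fin (n + 1) → 𝒳) → ℝ) (η : ℝ) : ℝ :=
  sInf (objectiveValues π h η)

/-! ### The coefficients of the expansion -/

/-- `E₀[h(X₁, …, X_T) | X_{t-1} = x, X_t = y]` for the transition `i`: the two states are fixed at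
`x` and `y`, all other states are integrated out independently under `π`. -/
def condMean (π : Measure 𝒳) {n : ℕ} (h : (Fin (n + 1) → 𝒳) → ℝ) (i : Fin n) (x y : 𝒳) : ℝ :=
  ∫ z, h (Function.update (Function.update z i.castSucc x) i.succ y) ∂(baseline π n)

/-- Resampling: replacing all but two coordinates by fresh ones preserves the i.i.d. law. -/
theorem map_resample (π : Measure 𝒳) [IsProbabilityMeasure π] {n : ℕ} (i : Fin n) :
    ((baseline π n).prod (baseline π n)).map
      (fun p => Function.update (Function.update p.2 i.castSucc (p.1 i.castSucc)) i.succ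
        (p.1 i.succ)) = baseline π n := by
  have hne : i.castSucc ≠ i.succ := Fin.castSucc_lt_succ.ne
  have hfun : (fun p : (Fin (n + 1) → 𝒳) × (Fin (n + 1) → 𝒳) =>
      Function.update (Function.update p.2 i.castSucc (p.1 i.castSucc)) i.succ (p.1 i.succ)) =
      fun p j => if j = i.castSucc ∨ j = i.succ then p.1 j else p.2 j := by
    funext p j
    by_cases h1 : j = i.succ
    · subst h1; simp
    · by_cases h2 : j = i.castSucc
      · subst h2; simp [hne]
      · simp [h1, h2]
  have hm : Measurable (fun (p : (Fin (n + 1) → 𝒳) × (Fin (n + 1) → 𝒳)) j =>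
      if j = i.castSucc ∨ j = i.succ then p.1 j else p.2 j) := by
    refine measurable_pi_lambda _ fun j => ?_
    by_cases hj : j = i.castSucc ∨ j = i.succ
    · simp only [hj, if_true]; fun_prop
    · simp only [hj, if_false]; fun_prop
  rw [hfun]
  have : IsProbabilityMeasure (baseline π n) := by unfold baseline; infer_instance
  refine (Measure.pi_eq fun s hs => ?_).symm
  rw [Measure.map_apply hm (MeasurableSet.univ_pi hs)]
  have hpre : (fun (p : (Fin (n + 1) → 𝒳) × (Fin (n + 1) → 𝒳)) j =>
      if j = i.castSucc ∨ j = i.succ then p.1 j else p.2 j) ⁻¹' (Set.univ.pi s) =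
      (Set.univ.pi fun j => if j = i.castSucc ∨ j = i.succ then s j else Set.univ) ×ˢ
      (Set.univ.pi fun j => if j = i.castSucc ∨ j = i.succ then Set.univ else s j) := by
    ext p
    simp only [Set.mem_preimage, Set.mem_pi, Set.mem_univ, true_imp_iff, Set.mem_prod]
    rw [← forall_and]
    refine forall_congr' fun j => ?_
    split_ifs <;> simp
  rw [hpre, Measure.prod_prod, baseline, Measure.pi_pi, Measure.pi_pi, ← Finset.prod_mul_distrib]
  refine Finset.prod_congr rfl fun j _ => ?_
  split_ifs <;> simp

/-- `condMean` is a version of the conditional expectation it stands for. -/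
theorem condExp_ae_eq_condMean (π : Measure 𝒳) [IsProbabilityMeasure π] {n : ℕ}
    (h : (Fin (n + 1) → 𝒳) → ℝ) (h_meas : Measurable h) (h_bdd : ∃ C : ℝ, ∀ x, |h x| ≤ C)
    (i : Fin n) :
    (baseline π n)[h | MeasurableSpace.comap (fun x => (x i.castSucc, x i.succ)) inferInstance]
      =ᵐ[baseline π n] fun x => condMean π h i (x i.castSucc) (x i.succ) := by
  obtain ⟨C, hC⟩ := h_bdd
  have : IsProbabilityMeasure (baseline π n) := by unfold baseline; infer_instance
  have hne : i.castSucc ≠ i.succ := Fin.castSucc_lt_succ.ne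
  have hpair : Measurable fun x : Fin (n + 1) → 𝒳 => (x i.castSucc, x i.succ) := by fun_prop
  have hint : Integrable h (baseline π n) :=
    Integrable.of_bound h_meas.aestronglyMeasurable C (ae_of_all _ hC)
  have hm3 : Measurable fun q : (𝒳 × 𝒳) × (Fin (n + 1) → 𝒳) =>
      Function.update (Function.update q.2 i.castSucc q.1.1) i.succ q.1.2 := by
    refine measurable_pi_lambda _ fun j => ?_
    by_cases h1 : j = i.succ
    · subst h1; simp; fun_prop
    · by_cases h2 : j = i.castSucc
      · subst h2; simp [hne]; fun_prop
      · simp [h1, h2]; fun_prop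
  have hcm : Measurable fun q : 𝒳 × 𝒳 => condMean π h i q.1 q.2 :=
    (StronglyMeasurable.integral_prod_right'
      (h_meas.comp hm3).stronglyMeasurable).measurable
  have hcb : ∀ x y, |condMean π h i x y| ≤ C := fun x y => by
    have := norm_integral_le_of_norm_le_const (μ := baseline π n) (C := C)
      (f := fun z => h (Function.update (Function.update z i.castSucc x) i.succ y))
      (ae_of_all _ fun z => hC _)
    simpa [condMean] using this
  refine (ae_eq_condExp_of_forall_setIntegral_eq hpair.comap_le hint
    (fun s _ _ => (Integrable.of_bound (hcm.comp hpair).aestronglyMeasurable C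
      (ae_of_all _ fun x => hcb _ _)).integrableOn) ?_ ?_).symm
  · rintro _ ⟨S, hS, rfl⟩ -
    have hS' := hpair hS
    rw [← integral_indicator hS', ← integral_indicator hS']
    conv_rhs => rw [← map_resample π i]
    have hΦ : Measurable fun p : (Fin (n + 1) → 𝒳) × (Fin (n + 1) → 𝒳) =>
        Function.update (Function.update p.2 i.castSucc (p.1 i.castSucc)) i.succ (p.1 i.succ) :=
      hm3.comp ((hpair.comp measurable_fst).prodMk measurable_snd)
    rw [integral_map hΦ.aemeasurable (h_meas.indicator hS').aestronglyMeasurable,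
      integral_prod]
    · refine integral_congr_ae (ae_of_all _ fun x => ?_)
      by_cases hx : (x i.castSucc, x i.succ) ∈ S
      · simp [Set.indicator, hx, hne, condMean]
      · simp [Set.indicator, hx, hne]
    · exact Integrable.of_bound ((h_meas.indicator hS').comp hΦ).aestronglyMeasurable C
        (ae_of_all _ fun p => (norm_indicator_le_norm_self _ _).trans (hC _))
  · exact (hcm.comp (comap_measurable _)).aestronglyMeasurable

/-- `H(x, y) = ∑_{t=2}^T E₀[h(X₁, …, X_T) | X_{t-1} = x, X_t = y]`. -/
def H (π : Measure 𝒳) {n : ℕ} (h : (Fin (n + 1) → 𝒳) → ℝ) (x y : 𝒳) : ℝ :=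
  ∑ i : Fin n, condMean π h i x y

/-- The interaction part
`R(x, y) = H(x, y) - E₀[H(X, Y) | X = x] - E₀[H(X, Y) | Y = y] + E₀[H(X, Y)]` of `H`, where `X` and
`Y` are independent with distribution `π`. -/
def R (π : Measure 𝒳) {n : ℕ} (h : (Fin (n + 1) → 𝒳) → ℝ) (x y : 𝒳) : ℝ :=
  H π h x y - ∫ y', H π h x y' ∂π - ∫ x', H π h x' y ∂π +
    ∫ p : 𝒳 × 𝒳, H π h p.1 p.2 ∂(π.prod π)

/-- `Var₀(R(X, Y))`, where `X` and `Y` are independent with distribution `π`. -/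
def varR (π : Measure 𝒳) {n : ℕ} (h : (Fin (n + 1) → 𝒳) → ℝ) : ℝ :=
  variance (fun p : 𝒳 × 𝒳 => R π h p.1 p.2) (π.prod π)

/-- `Ξ₁ = √Var₀(R(X, Y))`. -/
def Xi₁ (π : Measure 𝒳) {n : ℕ} (h : (Fin (n + 1) → 𝒳) → ℝ) : ℝ :=
  √(varR π h)

/-- `Ξ₂ = (∑_{s<t} E₀[R(X_{s-1}, X_s) R(X_{t-1}, X_t) h(X₁, …, X_T)]) / Var₀(R(X, Y))`, the sum
being over all pairs of transitions `s < t`. -/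
def Xi₂ (π : Measure 𝒳) {n : ℕ} (h : (Fin (n + 1) → 𝒳) → ℝ) : ℝ :=
  (∑ t : Fin n, ∑ s ∈ Finset.univ.filter (fun s : Fin n => s < t),
    ∫ x, R π h (x s.castSucc) (x s.succ) * R π h (x t.castSucc) (x t.succ) * h x
      ∂(baseline π n)) / varR π h

end SerialDependency

end

/-! The problem reduces to maximizing a smooth function over a small ball intersected with a convex
set in a Hilbert space. Stationarity makes all pairs (X_{t-1}, X_t) equidistributed, and finiteness
of the φ²-coefficient gives the pair law a density 1 + w with respect to π × π. One-dependence is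
the Markov property, so this density determines the whole law (`eq_chainLaw_of_isOneDependent`).
Conversely, every w in L²(π × π) with 1 + w ≥ 0 and vanishing marginals defines a feasible chain
when ‖w‖² ≤ η, since ‖w‖² is its φ²-coefficient. By `objectiveValues_eq_image`, the attainable
values are therefore those of F(w) = E₀[h ∏ (1 + w(X_{t-1}, X_t))] on K ∩ {‖w‖ ≤ √η}, with K closed
and convex.

F is a polynomial on L². Integrability of a product of n square-integrable factors is not automatic;
here consecutive factors share a single state, and the Hilbert-Schmidt estimate
`sq_lintegral_chain_mul_le` bounds the product. On K the derivative of F at 0 is the inner product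
with R: it is E₀[H w], and the one-variable functions by which H and R differ are orthogonal to
every w with vanishing marginals. As R is bounded and doubly centred, small multiples of R lie in K,
so the positivity constraint does not obstruct the ascent direction.

On a ball of small radius ρ, the curvature of the sphere, weighted by the nonzero gradient, is of
order ‖R‖/ρ and dominates the bounded second-order behaviour of F. Two distinct points of the ball
can thus be improved upon by an amount of order ‖R‖/ρ times their squared distance
(`exists_image_ge_average_add`). This yields two things. Maximizing sequences are Cauchy, so the
maximum is attained without compactness. And the maximizer is within O(ρ²) of z = ρR/‖R‖; since F
changes by at most O(ρ) times the distance when leaving z within the ball, F(z) is optimal up to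
O(ρ³).

It remains to expand F(tR) to second order at t = √η/‖R‖: the linear term is t‖R‖² = Ξ₁√η, the
quadratic one Ξ₂η. The minimum follows by replacing h by -h. -/

noncomputable section

set_option linter.unusedSectionVars false

namespace SerialDependency

variable {𝒳 : Type*} [MeasurableSpace 𝒳]

/-! ### Maximization over small balls of a Hilbert space -/

section Hilbert

variable {E : Type*} [NormedAddCommGroup E] [InnerProductSpace ℝ E]

/-- A function with Lipschitz derivative on a ball around the origin is close to its linearization
at the origin. -/
theorem abs_sub_sub_fderiv_zero_le {F : E → ℝ} {δ L : ℝ}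
    (hF : ∀ x ∈ Metric.ball (0 : E) δ, DifferentiableAt ℝ F x)
    (hL : ∀ x ∈ Metric.ball (0 : E) δ, ∀ y ∈ Metric.ball (0 : E) δ,
      ‖fderiv ℝ F x - fderiv ℝ F y‖ ≤ L * ‖x - y‖)
    (hL0 : 0 ≤ L) {ρ : ℝ} (hρ0 : 0 ≤ ρ) (hρ : ρ < δ) {u v : E} (hu : ‖u‖ ≤ ρ) (hv : ‖v‖ ≤ ρ) :
    |F u - F v - fderiv ℝ F 0 (u - v)| ≤ L * ρ * ‖u - v‖ := by
  have hsub : ∀ x ∈ Metric.closedBall (0 : E) ρ, x ∈ Metric.ball (0 : E) δ := fun x hx =>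
    Metric.closedBall_subset_ball hρ hx
  have := (convex_closedBall (0 : E) ρ).norm_image_sub_le_of_norm_hasFDerivWithin_le'
    (f := F) (f' := fderiv ℝ F) (φ := fderiv ℝ F 0) (C := L * ρ) (x := v) (y := u)
    (fun x hx => (hF x (hsub x hx)).hasFDerivAt.hasFDerivWithinAt)
    (fun x hx => by
      have h1 := hL x (hsub x hx) 0 (by simpa using hρ0.trans_lt hρ)
      have h2 : ‖x‖ ≤ ρ := by simpa using hx
      calc _ ≤ L * ‖x - 0‖ := h1
        _ ≤ L * ρ := by rw [sub_zero]; gcongr)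
    (by simpa using hv) (by simpa using hu)
  simpa [Real.norm_eq_abs] using this

/-- A function with Lipschitz derivative on a ball is almost concave at midpoints. -/
theorem le_image_midpoint {F : E → ℝ} {δ L : ℝ}
    (hF : ∀ x ∈ Metric.ball (0 : E) δ, DifferentiableAt ℝ F x)
    (hL : ∀ x ∈ Metric.ball (0 : E) δ, ∀ y ∈ Metric.ball (0 : E) δ,
      ‖fderiv ℝ F x - fderiv ℝ F y‖ ≤ L * ‖x - y‖)
    (hL0 : 0 ≤ L) {u v : E} (hu : u ∈ Metric.ball (0 : E) δ) (hv : v ∈ Metric.ball (0 : E) δ) :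
    (F u + F v) / 2 - L * ‖u - v‖ ^ 2 ≤ F (midpoint ℝ u v) := by
  set m := midpoint ℝ u v with hm
  have hmu : u - m = (1 / 2 : ℝ) • (u - v) := by
    rw [hm, midpoint_eq_smul_add, invOf_eq_inv]; module
  have hmv : v - m = -((1 / 2 : ℝ) • (u - v)) := by
    rw [hm, midpoint_eq_smul_add, invOf_eq_inv]; module
  have hcb : Convex ℝ (Metric.ball (0 : E) δ) := convex_ball _ _
  have hmb : m ∈ Metric.ball (0 : E) δ := hcb.midpoint_mem hu hv
  have key : ∀ w ∈ Metric.ball (0 : E) δ, ‖w - m‖ ≤ ‖u - v‖ →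
      |F w - F m - fderiv ℝ F m (w - m)| ≤ L * ‖u - v‖ * ‖w - m‖ := by
    intro w hw hwm
    have := (convex_segment m w).norm_image_sub_le_of_norm_hasFDerivWithin_le'
      (f := F) (f' := fderiv ℝ F) (φ := fderiv ℝ F m) (C := L * ‖u - v‖) (x := m) (y := w)
      (fun x hx => (hF x (hcb.segment_subset hmb hw hx)).hasFDerivAt.hasFDerivWithinAt)
      (fun x hx => by
        have h1 := hL x (hcb.segment_subset hmb hw hx) m hmb
        have h2 : ‖x - m‖ ≤ ‖w - m‖ := by
          obtain ⟨a, b, ha, hb, hab, rfl⟩ := hx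
          have : a • m + b • w - m = b • (w - m) := by
            rw [show a = 1 - b by linarith]; module
          rw [this, norm_smul, Real.norm_eq_abs, abs_of_nonneg hb]
          exact mul_le_of_le_one_left (norm_nonneg _) (by linarith)
        exact h1.trans (by gcongr; exact h2.trans hwm))
      (left_mem_segment _ _ _) (right_mem_segment _ _ _)
    simpa [Real.norm_eq_abs] using this
  have hnu : ‖u - m‖ = ‖u - v‖ / 2 := by rw [hmu, norm_smul]; norm_num; ring
  have hnv : ‖v - m‖ = ‖u - v‖ / 2 := by rw [hmv, norm_neg, norm_smul]; norm_num; ring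
  have h0 := norm_nonneg (u - v)
  have h1 := key u hu (by rw [hnu]; linarith)
  have h2 := key v hv (by rw [hnv]; linarith)
  -- The endpoints are opposite as seen from the midpoint, so the first-order terms cancel in the
  -- average and only the Lipschitz errors remain.
  have h3 : fderiv ℝ F m (v - m) = - fderiv ℝ F m (u - m) := by rw [hmv, hmu, map_neg]
  rw [hnu, abs_le] at h1
  rw [hnv, h3, abs_le] at h2
  have h4 : 0 ≤ L * ‖u - v‖ ^ 2 := by positivity
  nlinarith [h1.1, h2.1]

/-- Two points of a small ball in a convex set can be improved upon by a third one, because the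
curvature of the ball dominates the one of the objective. -/
theorem exists_image_ge_average_add {F : E → ℝ} {δ L t₀ ρ : ℝ} {K : Set E} {r : E}
    (hF : ∀ x ∈ Metric.ball (0 : E) δ, DifferentiableAt ℝ F x)
    (hL : ∀ x ∈ Metric.ball (0 : E) δ, ∀ y ∈ Metric.ball (0 : E) δ,
      ‖fderiv ℝ F x - fderiv ℝ F y‖ ≤ L * ‖x - y‖)
    (hL0 : 0 ≤ L) (hK : Convex ℝ K) (hr : 0 < ‖r‖)
    (hlin : ∀ w ∈ K, fderiv ℝ F 0 w = inner ℝ r w)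
    (hrK : ∀ t : ℝ, 0 ≤ t → t ≤ t₀ → t • r ∈ K)
    (hρ0 : 0 < ρ) (hρ : ρ < δ) (hρt : 2 * ρ / ‖r‖ ≤ t₀) (hρL : 38 * L * ρ ≤ ‖r‖)
    {v w : E} (hvK : v ∈ K) (hwK : w ∈ K) (hv : ‖v‖ ≤ ρ) (hw : ‖w‖ ≤ ρ) :
    ∃ u ∈ K, ‖u‖ ≤ ρ ∧ (F v + F w) / 2 + ‖r‖ / (32 * ρ) * ‖v - w‖ ^ 2 ≤ F u := by
  set d := ‖v - w‖ ^ 2 with hd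
  set m := midpoint ℝ v w with hm
  have hm' : m = (1 / 2 : ℝ) • (v + w) := by rw [hm, midpoint_eq_smul_add, invOf_eq_inv]; norm_num
  have hmK : m ∈ K := hK.midpoint_mem hvK hwK
  have hpar := parallelogram_law_with_norm ℝ v w
  have hd0 : 0 ≤ d := by positivity
  have hd4 : d ≤ 4 * ρ ^ 2 := by
    have : ‖v - w‖ ≤ 2 * ρ := (norm_sub_le _ _).trans (by linarith)
    rw [hd]; nlinarith [norm_nonneg (v - w)]
  have hmn : ‖m‖ ^ 2 ≤ ρ ^ 2 - d / 4 := by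
    have h1 : ‖m‖ = ‖v + w‖ / 2 := by rw [hm', norm_smul]; norm_num; ring
    rw [h1, hd]
    nlinarith [norm_nonneg v, norm_nonneg w, mul_self_le_mul_self (norm_nonneg v) hv,
      mul_self_le_mul_self (norm_nonneg w) hw]
  -- Strict convexity of the ball: the midpoint keeps a distance of order d/ρ from the sphere, and
  -- this slack is spent on moving in the direction of `r`.
  have hmρ : ‖m‖ ≤ ρ - d / (8 * ρ) := by
    have h0 : 0 ≤ ρ - d / (8 * ρ) := by
      rw [sub_nonneg, div_le_iff₀ (by positivity)]; nlinarith
    refine (pow_le_pow_iff_left₀ (norm_nonneg _) h0 two_ne_zero).1 ?_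
    have : (ρ - d / (8 * ρ)) ^ 2 = ρ ^ 2 - d / 4 + (d / (8 * ρ)) ^ 2 := by field_simp; ring
    rw [this]
    nlinarith [sq_nonneg (d / (8 * ρ))]
  have hmρ' : ‖m‖ ≤ ρ := hmρ.trans (by have : 0 ≤ d / (8 * ρ) := by positivity
                                       linarith)
  -- Translating `m` along `r` might leave `K`, so `m` is moved along the segment to a multiple of
  -- `r` that lies in `K`. Norm 2ρ ensures that ⟨r, p - m⟩ is at least ρ‖r‖.
  set p := (2 * ρ / ‖r‖) • r with hp
  have hpK : p ∈ K := hrK _ (by positivity) hρt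
  have hpn : ‖p‖ = 2 * ρ := by
    rw [hp, norm_smul, Real.norm_eq_abs, abs_of_nonneg (by positivity)]; field_simp
  -- The largest step that the slack d/(8ρ) pays for, as the move costs at most s · 2ρ in norm.
  set s := d / (16 * ρ ^ 2) with hs
  have hs0 : 0 ≤ s := by positivity
  have hs1 : s ≤ 1 := by rw [hs, div_le_one (by positivity)]; nlinarith
  set u := (1 - s) • m + s • p with hu
  have huK : u ∈ K := hK hmK hpK (by linarith) hs0 (by ring)
  have hum : u - m = s • (p - m) := by rw [hu]; module
  have hun : ‖u‖ ≤ ρ := by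
    calc ‖u‖ ≤ ‖(1 - s) • m‖ + ‖s • p‖ := norm_add_le _ _
      _ = (1 - s) * ‖m‖ + s * (2 * ρ) := by
        rw [norm_smul, norm_smul, hpn, Real.norm_eq_abs, Real.norm_eq_abs, abs_of_nonneg hs0,
          abs_of_nonneg (by linarith)]
      _ ≤ ‖m‖ + s * (2 * ρ) := by nlinarith [norm_nonneg m]
      _ ≤ ρ - d / (8 * ρ) + s * (2 * ρ) := by linarith
      _ = ρ := by rw [hs]; field_simp; ring
  refine ⟨u, huK, hun, ?_⟩
  have hb : ∀ x : E, ‖x‖ ≤ ρ → x ∈ Metric.ball (0 : E) δ := fun x hx => by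
    simpa using hx.trans_lt hρ
  have e1 := le_image_midpoint hF hL hL0 (hb v hv) (hb w hw)
  have e2 := abs_sub_sub_fderiv_zero_le hF hL hL0 hρ0.le hρ hun hmρ'
  have e3 : fderiv ℝ F 0 (u - m) = s * (inner ℝ r p - inner ℝ r m) := by
    rw [hum, map_smul, map_sub, hlin p hpK, hlin m hmK, smul_eq_mul]
  have e4 : inner ℝ r p = 2 * ρ * ‖r‖ := by
    rw [hp, inner_smul_right, real_inner_self_eq_norm_sq]; field_simp
  have e5 : inner ℝ r m ≤ ‖r‖ * ρ := (real_inner_le_norm r m).trans (by gcongr)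
  have e6 : ‖u - m‖ ≤ s * (3 * ρ) := by
    rw [hum, norm_smul, Real.norm_eq_abs, abs_of_nonneg hs0]
    gcongr
    exact (norm_sub_le _ _).trans (by linarith)
  have e7 : s * (ρ * ‖r‖) ≤ fderiv ℝ F 0 (u - m) := by
    rw [e3, e4]
    gcongr
    linarith
  have e8 : L * ρ * ‖u - m‖ ≤ L * ρ * (s * (3 * ρ)) := by gcongr
  rw [abs_le] at e2
  have e9 : d = s * (16 * ρ ^ 2) := by rw [hs]; field_simp
  have e10 : ‖r‖ / (32 * ρ) * d = s * (ρ * ‖r‖) / 2 := by rw [e9]; field_simp; ring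
  -- The losses are L d = 16 s L ρ² at the midpoint and 3 s L ρ² in linearizing the move. Together
  -- these 19 s L ρ² consume at most half of the gain s ρ ‖r‖; the other half is the asserted
  -- improvement.
  have e11 : 0 ≤ s * ρ * (‖r‖ - 38 * L * ρ) := by
    have : 0 ≤ ‖r‖ - 38 * L * ρ := by linarith
    positivity
  rw [e10]
  rw [← hd, ← hm, e9] at e1
  nlinarith [e2.1]

/-- Maximization over a closed convex subset of a small ball, when the gradient of the objective at
the origin does not vanish: the maximum is attained and differs by `O(ρ³)` from the value at the
multiple of the gradient of norm `ρ`. -/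
theorem exists_isMaxOn_inter_closedBall [CompleteSpace E] {F : E → ℝ} (hF : ContDiff ℝ 2 F)
    {K : Set E} (hK : Convex ℝ K) (hKc : IsClosed K) {r : E} (hr : r ≠ 0)
    (hlin : ∀ w ∈ K, fderiv ℝ F 0 w = inner ℝ r w) {t₀ : ℝ} (ht₀ : 0 < t₀)
    (hrK : ∀ t : ℝ, 0 ≤ t → t ≤ t₀ → t • r ∈ K) :
    ∃ C : ℝ, ∀ᶠ ρ : ℝ in 𝓝[>] 0, (ρ / ‖r‖) • r ∈ K ∧ ∃ w ∈ K, ‖w‖ ≤ ρ ∧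
      (∀ v ∈ K, ‖v‖ ≤ ρ → F v ≤ F w) ∧ F w ≤ F ((ρ / ‖r‖) • r) + C * ρ ^ 3 := by
  have hr' : 0 < ‖r‖ := norm_pos_iff.2 hr
  obtain ⟨L₀, t, ht, hLt⟩ := ((hF.fderiv_right (m := 1) (by norm_num)).contDiffAt
    (x := (0 : E))).exists_lipschitzOnWith
  obtain ⟨δ, hδ, hδt⟩ := Metric.mem_nhds_iff.1 ht
  set L : ℝ := (L₀ : ℝ) with hLdef
  have hL0 : 0 ≤ L := L₀.2
  have hL : ∀ x ∈ Metric.ball (0 : E) δ, ∀ y ∈ Metric.ball (0 : E) δ,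
      ‖fderiv ℝ F x - fderiv ℝ F y‖ ≤ L * ‖x - y‖ := fun x hx y hy => by
    simpa [dist_eq_norm] using hLt.dist_le_mul x (hδt hx) y (hδt hy)
  have hFd : Differentiable ℝ F := hF.differentiable (by norm_num)
  have hFb : ∀ x ∈ Metric.ball (0 : E) δ, DifferentiableAt ℝ F x := fun x _ => hFd x
  refine ⟨16 * L ^ 2 / ‖r‖, ?_⟩
  have hsmall : ∀ᶠ ρ : ℝ in 𝓝[>] 0, 0 < ρ ∧ ρ < δ ∧ ρ < t₀ * ‖r‖ / 2 ∧
      ρ < ‖r‖ / (38 * L + 1) := by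
    refine (eventually_mem_nhdsWithin).and (Filter.Eventually.filter_mono nhdsWithin_le_nhds ?_)
    exact (eventually_lt_nhds hδ).and ((eventually_lt_nhds (by positivity)).and
      (eventually_lt_nhds (by positivity)))
  filter_upwards [hsmall] with ρ ⟨hρ0, hρδ, hρt, hρL⟩
  have hρt' : 2 * ρ / ‖r‖ ≤ t₀ := by rw [div_le_iff₀ hr']; linarith
  have hρL' : 38 * L * ρ ≤ ‖r‖ := by
    rw [lt_div_iff₀ (by positivity)] at hρL
    nlinarith
  set z := (ρ / ‖r‖) • r with hz
  have hzK : z ∈ K := hrK _ (by positivity) (le_trans (by gcongr; linarith) hρt')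
  have hzn : ‖z‖ = ρ := by
    rw [hz, norm_smul, Real.norm_eq_abs, abs_of_nonneg (by positivity)]; field_simp
  have improve : ∀ v ∈ K, ∀ w ∈ K, ‖v‖ ≤ ρ → ‖w‖ ≤ ρ → ∃ u ∈ K, ‖u‖ ≤ ρ ∧
      (F v + F w) / 2 + ‖r‖ / (32 * ρ) * ‖v - w‖ ^ 2 ≤ F u := fun v hv w hw hvn hwn =>
    exists_image_ge_average_add hFb hL hL0 hK hr' hlin hrK hρ0 hρδ hρt' hρL' hv hw hvn hwn
  refine ⟨hzK, ?_⟩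
  -- By Cauchy-Schwarz, `z` maximizes the linear part on the ball, so only the linearization error
  -- can favour `v`.
  have hclose : ∀ v ∈ K, ‖v‖ ≤ ρ → F v - F z ≤ L * ρ * ‖v - z‖ := fun v hv hvn => by
    have h1 := abs_sub_sub_fderiv_zero_le hFb hL hL0 hρ0.le hρδ hvn hzn.le
    rw [map_sub, hlin v hv, hlin z hzK, abs_le] at h1
    have h2 : inner ℝ r z = ρ * ‖r‖ := by
      rw [hz, inner_smul_right, real_inner_self_eq_norm_sq]; field_simp
    have h3 : inner ℝ r v ≤ ‖r‖ * ρ := (real_inner_le_norm r v).trans (by gcongr)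
    nlinarith [h1.2]
  set A : Set ℝ := F '' {w | w ∈ K ∧ ‖w‖ ≤ ρ} with hA
  have hAne : A.Nonempty := ⟨F z, z, ⟨hzK, hzn.le⟩, rfl⟩
  have hAbdd : BddAbove A := by
    refine ⟨F z + L * ρ * (2 * ρ), ?_⟩
    rintro _ ⟨v, ⟨hv, hvn⟩, rfl⟩
    have h1 := hclose v hv hvn
    have h2 : ‖v - z‖ ≤ 2 * ρ := (norm_sub_le _ _).trans (by linarith)
    have h3 : L * ρ * ‖v - z‖ ≤ L * ρ * (2 * ρ) := by gcongr
    linarith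
  set M := sSup A with hM
  have hle : ∀ v ∈ K, ‖v‖ ≤ ρ → F v ≤ M := fun v hv hvn => le_csSup hAbdd ⟨v, ⟨hv, hvn⟩, rfl⟩
  have hseq : ∀ k : ℕ, ∃ w, (w ∈ K ∧ ‖w‖ ≤ ρ) ∧ M - 1 / ((k : ℝ) + 1) < F w := fun k => by
    obtain ⟨_, ⟨w, hw, rfl⟩, hw'⟩ := exists_lt_of_lt_csSup hAne
      (show M - 1 / ((k : ℝ) + 1) < sSup A by
        have : 0 < 1 / ((k : ℝ) + 1) := by positivity
        linarith)
    exact ⟨w, hw, hw'⟩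
  choose w hw hwM using hseq
  -- Two almost optimal points must be close, because the improvement they allow cannot exceed the
  -- optimality gap. This replaces weak compactness.
  have hdist : ∀ k l N : ℕ, N ≤ k → N ≤ l →
      dist (w k) (w l) ≤ √(32 * ρ / ‖r‖ * (1 / ((N : ℝ) + 1))) := by
    intro k l N hk hl
    rw [dist_eq_norm]
    apply Real.le_sqrt_of_sq_le
    obtain ⟨u, hu, hun, hFu⟩ := improve _ (hw k).1 _ (hw l).1 (hw k).2 (hw l).2
    have h1 := hle u hu hun
    have h2 : 1 / ((k : ℝ) + 1) ≤ 1 / ((N : ℝ) + 1) := by gcongr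
    have h3 : 1 / ((l : ℝ) + 1) ≤ 1 / ((N : ℝ) + 1) := by gcongr
    have h4 := hwM k
    have h5 := hwM l
    have h6 : ‖r‖ / (32 * ρ) * ‖w k - w l‖ ^ 2 ≤ 1 / ((N : ℝ) + 1) := by linarith
    calc ‖w k - w l‖ ^ 2 = 32 * ρ / ‖r‖ * (‖r‖ / (32 * ρ) * ‖w k - w l‖ ^ 2) := by field_simp
      _ ≤ _ := by gcongr
  have hcau : CauchySeq w := by
    refine cauchySeq_of_le_tendsto_0 _ hdist ?_
    have h1 : Tendsto (fun N : ℕ => 32 * ρ / ‖r‖ * (1 / ((N : ℝ) + 1))) atTop (𝓝 0) := by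
      simpa using tendsto_one_div_add_atTop_nhds_zero_nat.const_mul (32 * ρ / ‖r‖)
    simpa using h1.sqrt
  obtain ⟨x, hx⟩ := cauchySeq_tendsto_of_complete hcau
  have hxK : x ∈ K := hKc.mem_of_tendsto hx (Eventually.of_forall fun k => (hw k).1)
  have hxn : ‖x‖ ≤ ρ := le_of_tendsto hx.norm (Eventually.of_forall fun k => (hw k).2)
  have hFx : M ≤ F x := by
    have h1 : Tendsto (fun k => F (w k)) atTop (𝓝 (F x)) := (hFd.continuous.tendsto x).comp hx
    have h2 : Tendsto (fun k : ℕ => M - 1 / ((k : ℝ) + 1)) atTop (𝓝 M) := by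
      simpa using tendsto_one_div_add_atTop_nhds_zero_nat.const_sub M
    exact le_of_tendsto_of_tendsto h2 h1 (Eventually.of_forall fun k => (hwM k).le)
  refine ⟨x, hxK, hxn, fun v hv hvn => (hle v hv hvn).trans hFx, ?_⟩
  -- Optimality of `x` makes F x - F z at least quadratic in ‖x - z‖, while `hclose` makes it at
  -- most linear. Hence ‖x - z‖ = O(ρ²), and `hclose` again gives O(ρ³).
  obtain ⟨u, hu, hun, hFu⟩ := improve x hxK z hzK hxn hzn.le
  have h1 := (hle u hu hun).trans hFx
  have h2 := hclose x hxK hxn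
  have hdn := norm_nonneg (x - z)
  have h3 : ‖r‖ / (16 * ρ) * ‖x - z‖ ^ 2 ≤ L * ρ * ‖x - z‖ := by
    have : ‖r‖ / (16 * ρ) = 2 * (‖r‖ / (32 * ρ)) := by field_simp; norm_num
    rw [this]; linarith
  have h4 : ‖x - z‖ ≤ 16 * L * ρ ^ 2 / ‖r‖ := by
    rcases hdn.eq_or_lt with h0 | h0
    · rw [← h0]; positivity
    · rw [sq, ← mul_assoc] at h3
      have h5 := le_of_mul_le_mul_right h3 h0
      calc ‖x - z‖ = 16 * ρ / ‖r‖ * (‖r‖ / (16 * ρ) * ‖x - z‖) := by field_simp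
        _ ≤ 16 * ρ / ‖r‖ * (L * ρ) := by gcongr
        _ = _ := by ring
  have h6 : L * ρ * ‖x - z‖ ≤ L * ρ * (16 * L * ρ ^ 2 / ‖r‖) := by gcongr
  have h7 : L * ρ * (16 * L * ρ ^ 2 / ‖r‖) = 16 * L ^ 2 / ‖r‖ * ρ ^ 3 := by ring
  linarith

end Hilbert

/-! ### Integration with respect to the baseline law -/

section Baseline

variable {n : ℕ} (π : Measure 𝒳) [IsProbabilityMeasure π]

instance isProbabilityMeasure_baseline : IsProbabilityMeasure (baseline π n) := by
  unfold baseline; infer_instance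

theorem measurePreserving_eval_baseline (t : Fin (n + 1)) :
    MeasurePreserving (fun x : Fin (n + 1) → 𝒳 => x t) (baseline π n) π :=
  measurePreserving_eval (fun _ => π) t

theorem measurable_glue (p : Fin (n + 1) → Prop) [DecidablePred p] :
    Measurable fun (q : (Fin (n + 1) → 𝒳) × (Fin (n + 1) → 𝒳)) j =>
      if p j then q.1 j else q.2 j := by
  refine measurable_pi_lambda _ fun j => ?_
  by_cases hj : p j
  · simp only [hj, if_true]; fun_prop
  · simp only [hj, if_false]; fun_prop

/-- Replacing some of the coordinates by those of an independent copy preserves the baseline. -/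
theorem map_glue (p : Fin (n + 1) → Prop) [DecidablePred p] :
    ((baseline π n).prod (baseline π n)).map
      (fun q j => if p j then q.1 j else q.2 j) = baseline π n := by
  refine (Measure.pi_eq fun s hs => ?_).symm
  rw [Measure.map_apply (measurable_glue p) (MeasurableSet.univ_pi hs)]
  have hpre : (fun (q : (Fin (n + 1) → 𝒳) × (Fin (n + 1) → 𝒳)) j =>
      if p j then q.1 j else q.2 j) ⁻¹' (Set.univ.pi s) =
      (Set.univ.pi fun j => if p j then s j else Set.univ) ×ˢ
      (Set.univ.pi fun j => if p j then Set.univ else s j) := by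
    ext q
    simp only [Set.mem_preimage, Set.mem_pi, Set.mem_univ, true_imp_iff, Set.mem_prod]
    rw [← forall_and]
    refine forall_congr' fun j => ?_
    split_ifs <;> simp
  rw [hpre, Measure.prod_prod, baseline, Measure.pi_pi, Measure.pi_pi, ← Finset.prod_mul_distrib]
  refine Finset.prod_congr rfl fun j _ => ?_
  split_ifs <;> simp

/-- The law of two consecutive states under the baseline is the product law. -/
theorem measurePreserving_pair (i : Fin n) :
    MeasurePreserving (fun x : Fin (n + 1) → 𝒳 => (x i.castSucc, x i.succ)) (baseline π n)
      (π.prod π) := by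
  have hne : i.castSucc ≠ i.succ := Fin.castSucc_lt_succ.ne
  refine ⟨by fun_prop, (Measure.prod_eq fun s t hs ht => ?_).symm⟩
  rw [Measure.map_apply (by fun_prop) (hs.prod ht)]
  have : (fun x : Fin (n + 1) → 𝒳 => (x i.castSucc, x i.succ)) ⁻¹' (s ×ˢ t) =
      Set.univ.pi (fun j => if j = i.castSucc then s else if j = i.succ then t else Set.univ) := by
    ext x
    simp only [Set.mem_preimage, Set.mem_prod, Set.mem_pi, Set.mem_univ, true_imp_iff]
    constructor
    · rintro ⟨h1, h2⟩ j
      split_ifs with h h'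
      · rwa [h]
      · rwa [h']
      · trivial
    · intro hx
      have h1 := hx i.castSucc
      have h2 := hx i.succ
      simp only [if_true] at h1 h2
      rw [if_neg hne.symm] at h2
      exact ⟨h1, h2⟩
  rw [this, baseline, Measure.pi_pi, ← Finset.mul_prod_erase _ _ (Finset.mem_univ i.castSucc),
    if_pos rfl, ← Finset.mul_prod_erase _ _ (Finset.mem_erase.2 ⟨hne.symm, Finset.mem_univ i.succ⟩),
    if_neg hne.symm, if_pos rfl, Finset.prod_eq_one, mul_one]
  intro j hj
  simp only [Finset.mem_erase] at hj
  rw [if_neg hj.2.1, if_neg hj.1, measure_univ]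

/-- The conditional baseline mean of `g` given that the state at time `t` equals `c`. -/
def fiberMean (t : Fin (n + 1)) (g : (Fin (n + 1) → 𝒳) → ℝ≥0∞) (c : 𝒳) : ℝ≥0∞ :=
  ∫⁻ z, g (Function.update z t c) ∂(baseline π n)

theorem measurable_fiberMean (t : Fin (n + 1)) {g : (Fin (n + 1) → 𝒳) → ℝ≥0∞}
    (hg : Measurable g) : Measurable (fiberMean π t g) := by
  have h1 : Measurable fun q : 𝒳 × (Fin (n + 1) → 𝒳) => Function.update q.2 t q.1 := by
    refine measurable_pi_lambda _ fun j => ?_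
    by_cases h1 : j = t
    · subst h1; simp; fun_prop
    · simp [h1]; fun_prop
  exact (hg.comp h1).lintegral_prod_right'

/-- If `f` and `g` depend on complementary coordinates, with only the state at time `t` in common,
then the coordinates of `g` can be integrated out conditionally on that state. -/
theorem lintegral_mul_eq_lintegral_mul_fiberMean {S : Set (Fin (n + 1))} {t : Fin (n + 1)}
    (ht : t ∈ S) {f g : (Fin (n + 1) → 𝒳) → ℝ≥0∞} (hf : Measurable f) (hg : Measurable g)
    (hfS : DependsOn f S) (hgS : DependsOn g (insert t Sᶜ)) :
    ∫⁻ x, f x * g x ∂(baseline π n) = ∫⁻ x, f x * fiberMean π t g (x t) ∂(baseline π n) := by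
  classical
  -- Two independent copies are glued along `S`: `f` sees only the first copy, and `g` sees the
  -- second one except for the shared state at `t`.
  conv_lhs => rw [← map_glue π (fun j => j ∈ S)]
  have hfg : Measurable fun x => f x * g x := hf.mul hg
  have hc := hfg.comp (measurable_glue fun j => j ∈ S)
  simp only [Function.comp_def] at hc
  rw [lintegral_map hfg (measurable_glue _), lintegral_prod _ hc.aemeasurable]
  refine lintegral_congr fun x => ?_
  have h1 : ∀ z : Fin (n + 1) → 𝒳, f (fun j => if j ∈ S then x j else z j) = f x := fun z =>
    hfS fun j hj => by simp [hj]
  have h2 : ∀ z : Fin (n + 1) → 𝒳, g (fun j => if j ∈ S then x j else z j) =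
      g (Function.update z t (x t)) := fun z => hgS fun j hj => by
    rcases hj with rfl | hj
    · simp [ht]
    · have hjS : j ∉ S := hj
      have hjt : j ≠ t := fun h => hjS (h ▸ ht)
      simp [hjS, hjt]
  simp only [h1, h2]
  rw [lintegral_const_mul, fiberMean]
  have h3 : Measurable fun z : Fin (n + 1) → 𝒳 => Function.update z t (x t) := by
    refine measurable_pi_lambda _ fun j => ?_
    by_cases h1 : j = t
    · subst h1; simp
    · simp [h1]; fun_prop
  exact hg.comp h3

theorem dependsOn_pair {α : Type*} (k : 𝒳 × 𝒳 → α) (i : Fin n) {S : Set (Fin (n + 1))}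
    (h1 : i.castSucc ∈ S) (h2 : i.succ ∈ S) :
    DependsOn (fun x : Fin (n + 1) → 𝒳 => k (x i.castSucc, x i.succ)) S := fun x y h => by
  simp only [h _ h1, h _ h2]

/-- Integrating out the second state of a transition. -/
theorem lintegral_mul_pair_succ {i : Fin n} {f : (Fin (n + 1) → 𝒳) → ℝ≥0∞} {k : 𝒳 × 𝒳 → ℝ≥0∞}
    (hf : Measurable f) (hk : Measurable k) (hfS : DependsOn f {i.succ}ᶜ) :
    ∫⁻ x, f x * k (x i.castSucc, x i.succ) ∂(baseline π n) =
      ∫⁻ x, f x * ∫⁻ y, k (x i.castSucc, y) ∂π ∂(baseline π n) := by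
  have hne : i.castSucc ≠ i.succ := Fin.castSucc_lt_succ.ne
  rw [lintegral_mul_eq_lintegral_mul_fiberMean π (S := {i.succ}ᶜ) (t := i.castSucc) (by simpa)
    hf (by fun_prop) hfS (dependsOn_pair k i (by simp) (by simp))]
  refine lintegral_congr fun x => ?_
  congr 1
  rw [fiberMean, ← (measurePreserving_eval_baseline π i.succ).lintegral_comp
    (f := fun y => k (x i.castSucc, y)) (by fun_prop)]
  simp [Function.update_of_ne hne.symm]

/-- Integrating out the first state of a transition. -/
theorem lintegral_mul_pair_castSucc {i : Fin n} {f : (Fin (n + 1) → 𝒳) → ℝ≥0∞}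
    {k : 𝒳 × 𝒳 → ℝ≥0∞} (hf : Measurable f) (hk : Measurable k)
    (hfS : DependsOn f {i.castSucc}ᶜ) :
    ∫⁻ x, f x * k (x i.castSucc, x i.succ) ∂(baseline π n) =
      ∫⁻ x, f x * ∫⁻ y, k (y, x i.succ) ∂π ∂(baseline π n) := by
  have hne : i.castSucc ≠ i.succ := Fin.castSucc_lt_succ.ne
  rw [lintegral_mul_eq_lintegral_mul_fiberMean π (S := {i.castSucc}ᶜ) (t := i.succ)
    (by simpa using hne.symm) hf (by fun_prop) hfS (dependsOn_pair k i (by simp) (by simp))]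
  refine lintegral_congr fun x => ?_
  congr 1
  rw [fiberMean, ← (measurePreserving_eval_baseline π i.castSucc).lintegral_comp
    (f := fun y => k (y, x i.succ)) (by fun_prop)]
  simp [Function.update_of_ne hne]

end Baseline

/-! ### Products of kernels along consecutive transitions -/

section Chain

variable {n : ℕ}

/-- The product of the kernels `k i` along the transitions `i` with `a ≤ i < b`. -/
def chain (k : Fin n → 𝒳 × 𝒳 → ℝ≥0∞) (a b : ℕ) (x : Fin (n + 1) → 𝒳) : ℝ≥0∞ :=
  ∏ i with a ≤ i.val ∧ i.val < b, k i (x i.castSucc, x i.succ)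

theorem measurable_chain {k : Fin n → 𝒳 × 𝒳 → ℝ≥0∞} (hk : ∀ i, Measurable (k i)) (a b : ℕ) :
    Measurable (chain k a b) := by
  unfold chain
  exact Finset.measurable_fun_prod _ fun i _ => (hk i).comp (by fun_prop)

/-- Transition i joins the states i and i + 1, so the last transition b - 1 still involves the state
b and the bound on states is not strict. -/
theorem dependsOn_chain (k : Fin n → 𝒳 × 𝒳 → ℝ≥0∞) (a b : ℕ) :
    DependsOn (chain k a b) {j | a ≤ j.val ∧ j.val ≤ b} := fun x y h => by
  refine Finset.prod_congr rfl fun i hi => ?_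
  simp only [Finset.mem_filter, Finset.mem_univ, true_and] at hi
  have h1 := h i.castSucc ⟨hi.1, by simpa using hi.2.le⟩
  have h2 := h i.succ ⟨by simp; omega, by simp; omega⟩
  rw [h1, h2]

theorem chain_self (k : Fin n → 𝒳 × 𝒳 → ℝ≥0∞) (a : ℕ) (x : Fin (n + 1) → 𝒳) :
    chain k a a x = 1 := by
  refine Finset.prod_eq_one fun i hi => ?_
  simp only [Finset.mem_filter, Finset.mem_univ, true_and] at hi
  omega

theorem chain_succ_right (k : Fin n → 𝒳 × 𝒳 → ℝ≥0∞) {a : ℕ} (i : Fin n) (ha : a ≤ i.val)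
    (x : Fin (n + 1) → 𝒳) :
    chain k a (i.val + 1) x = chain k a i.val x * k i (x i.castSucc, x i.succ) := by
  have : Finset.univ.filter (fun j : Fin n => a ≤ j.val ∧ j.val < i.val + 1) =
      insert i (Finset.univ.filter (fun j : Fin n => a ≤ j.val ∧ j.val < i.val)) := by
    ext j
    simp only [Finset.mem_filter, Finset.mem_univ, true_and, Finset.mem_insert, Fin.ext_iff]
    omega
  rw [chain, this, Finset.prod_insert (by simp), mul_comm]; rfl

theorem chain_succ_left (k : Fin n → 𝒳 × 𝒳 → ℝ≥0∞) {b : ℕ} (i : Fin n) (hb : i.val < b)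
    (x : Fin (n + 1) → 𝒳) :
    chain k i.val b x = chain k (i.val + 1) b x * k i (x i.castSucc, x i.succ) := by
  have : Finset.univ.filter (fun j : Fin n => i.val ≤ j.val ∧ j.val < b) =
      insert i (Finset.univ.filter (fun j : Fin n => i.val + 1 ≤ j.val ∧ j.val < b)) := by
    ext j
    simp only [Finset.mem_filter, Finset.mem_univ, true_and, Finset.mem_insert, Fin.ext_iff]
    omega
  rw [chain, this, Finset.prod_insert (by simp), mul_comm]; rfl

theorem chain_mul_chain (k : Fin n → 𝒳 × 𝒳 → ℝ≥0∞) {a b c : ℕ} (hab : a ≤ b) (hbc : b ≤ c)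
    (x : Fin (n + 1) → 𝒳) : chain k a b x * chain k b c x = chain k a c x := by
  rw [chain, chain, chain, ← Finset.prod_union]
  · congr 1
    ext j
    simp only [Finset.mem_union, Finset.mem_filter, Finset.mem_univ, true_and]
    omega
  · rw [Finset.disjoint_left]
    intro j
    simp only [Finset.mem_filter, Finset.mem_univ, true_and]
    omega

theorem chain_zero_eq_prod (k : Fin n → 𝒳 × 𝒳 → ℝ≥0∞) (x : Fin (n + 1) → 𝒳) :
    chain k 0 n x = ∏ i, k i (x i.castSucc, x i.succ) := by
  rw [chain, Finset.filter_true_of_mem]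
  simp

/-- The Cauchy-Schwarz inequality for the Lebesgue integral, in squared form. -/
theorem sq_lintegral_mul_le {α : Type*} [MeasurableSpace α] (μ : Measure α) {f g : α → ℝ≥0∞}
    (hf : AEMeasurable f μ) (hg : AEMeasurable g μ) :
    (∫⁻ a, f a * g a ∂μ) ^ 2 ≤ (∫⁻ a, f a ^ 2 ∂μ) * ∫⁻ a, g a ^ 2 ∂μ := by
  have h := ENNReal.lintegral_mul_le_Lp_mul_Lq μ Real.HolderConjugate.two_two hf hg
  simp only [Pi.mul_apply, ENNReal.rpow_two] at h
  calc _ ≤ ((∫⁻ a, f a ^ 2 ∂μ) ^ (1 / 2 : ℝ) * (∫⁻ a, g a ^ 2 ∂μ) ^ (1 / 2 : ℝ)) ^ 2 := by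
        gcongr
    _ = _ := by
        rw [mul_pow, ← ENNReal.rpow_two, ← ENNReal.rpow_two, ← ENNReal.rpow_mul,
          ← ENNReal.rpow_mul]
        norm_num

variable (π : Measure 𝒳) [IsProbabilityMeasure π]

/-- A chain of kernels is bounded by the product of their Hilbert-Schmidt norms. -/
theorem sq_lintegral_chain_mul_le {k : Fin n → 𝒳 × 𝒳 → ℝ≥0∞} (hk : ∀ i, Measurable (k i)) (t : ℕ)
    (ht : t < n + 1) {f : 𝒳 → ℝ≥0∞} (hf : Measurable f) :
    (∫⁻ x, chain k 0 t x * f (x ⟨t, ht⟩) ∂(baseline π n)) ^ 2 ≤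
      (∏ i with 0 ≤ i.val ∧ i.val < t, ∫⁻ p, k i p ^ 2 ∂(π.prod π)) * ∫⁻ x, f x ^ 2 ∂π := by
  induction t generalizing f with
  | zero =>
    have h1 : ∫⁻ x, chain k 0 0 x * f (x ⟨0, ht⟩) ∂(baseline π n) = ∫⁻ x, 1 * f x ∂π := by
      simp only [chain_self]
      exact (measurePreserving_eval_baseline π ⟨0, ht⟩).lintegral_comp
        (f := fun x => 1 * f x) (by fun_prop)
    rw [h1]
    refine (sq_lintegral_mul_le π aemeasurable_const hf.aemeasurable).trans ?_
    simp
  | succ t ih =>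
    set i : Fin n := ⟨t, by omega⟩ with hi
    have h1 : ∀ x : Fin (n + 1) → 𝒳, chain k 0 (t + 1) x * f (x ⟨t + 1, ht⟩) =
        chain k 0 t x * (fun p : 𝒳 × 𝒳 => k i p * f p.2) (x i.castSucc, x i.succ) := fun x => by
      have := chain_succ_right k i (Nat.zero_le _) x
      simp only [hi] at this
      rw [this]
      simp [hi, mul_assoc]
    simp only [h1]
    have hkf : Measurable (fun p : 𝒳 × 𝒳 => k i p * f p.2) := (hk i).mul (by fun_prop)
    rw [lintegral_mul_pair_succ π (measurable_chain hk 0 t) hkf]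
    -- Integrating out the last state replaces `f` by its image under the integral operator with
    -- kernel `k i`. Cauchy-Schwarz in y bounds the L² norm of this image by the Hilbert-Schmidt
    -- norm of the kernel times the norm of `f`.
    · have hF : Measurable fun c => ∫⁻ y, k i (c, y) * f y ∂π := hkf.lintegral_prod_right'
      refine (ih (by omega) hF).trans ?_
      have h2 : Finset.univ.filter (fun j : Fin n => 0 ≤ j.val ∧ j.val < t + 1) =
          insert i (Finset.univ.filter (fun j : Fin n => 0 ≤ j.val ∧ j.val < t)) := by
        ext j
        simp only [Finset.mem_filter, Finset.mem_univ, true_and, Finset.mem_insert, Fin.ext_iff, hi]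
        omega
      rw [h2, Finset.prod_insert (by simp [hi]), mul_comm (∫⁻ p, k i p ^ 2 ∂(π.prod π)), mul_assoc]
      gcongr
      rw [lintegral_prod _ ((hk i).pow_const 2).aemeasurable, ← lintegral_mul_const]
      · refine lintegral_mono fun c => ?_
        exact sq_lintegral_mul_le π ((hk i).comp (by fun_prop)).aemeasurable hf.aemeasurable
      · exact ((hk i).pow_const 2).lintegral_prod_right'
    · intro x y hxy
      refine dependsOn_chain k 0 t fun j hj => hxy j ?_
      simp only [Set.mem_compl_iff, Set.mem_singleton_iff, Fin.ext_iff, hi, Fin.val_succ]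
      have := hj.2
      omega

/-- The full chain applied to f = 1. This is the estimate that makes the objective a bounded
multilinear form in L² kernels. -/
theorem sq_lintegral_prod_le {k : Fin n → 𝒳 × 𝒳 → ℝ≥0∞} (hk : ∀ i, Measurable (k i)) :
    (∫⁻ x, ∏ i, k i (x i.castSucc, x i.succ) ∂(baseline π n)) ^ 2 ≤
      ∏ i, ∫⁻ p, k i p ^ 2 ∂(π.prod π) := by
  have := sq_lintegral_chain_mul_le π hk n (by omega) (f := fun _ => 1) measurable_const
  simpa [chain_zero_eq_prod] using this

end Chain

section ChainLaw

variable {n : ℕ}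

/-! ### Past and future -/

theorem past_le (t : Fin (n + 1)) : past (𝒳 := 𝒳) t ≤ MeasurableSpace.pi :=
  iSup_le fun s => (measurable_pi_apply s.1).comap_le

theorem future_le (t : Fin (n + 1)) : future (𝒳 := 𝒳) t ≤ MeasurableSpace.pi :=
  iSup_le fun s => (measurable_pi_apply s.1).comap_le

theorem present_le (t : Fin (n + 1)) : present (𝒳 := 𝒳) t ≤ MeasurableSpace.pi :=
  (measurable_pi_apply t).comap_le

/-- A set in the `σ`-algebra generated by some coordinates depends on these coordinates only. -/
theorem dependsOn_indicator_of_measurableSet_iSup {p : Fin (n + 1) → Prop}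
    {A : Set (Fin (n + 1) → 𝒳)}
    (hA : MeasurableSet[⨆ s : {s // p s}, present s.1] A) {β : Type*} [Zero β] (c : β) :
    DependsOn (A.indicator fun _ => c) {j | p j} := by
  -- Only factorization through the selected coordinates matters, so the restricted paths may carry
  -- the σ-algebra ⊤.
  have hle : (⨆ s : {s // p s}, present (𝒳 := 𝒳) s.1) ≤
      MeasurableSpace.comap (fun x (s : {s // p s}) => x s.1) ⊤ := by
    refine iSup_le fun s => ?_
    rintro _ ⟨S, _, rfl⟩
    exact ⟨{r | r s ∈ S}, trivial, rfl⟩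
  obtain ⟨S, _, rfl⟩ := hle A hA
  intro x y hxy
  have : (fun s : {s // p s} => x s.1) = fun s => y s.1 := funext fun s => hxy s.1 s.2
  exact congrArg (S.indicator fun _ => c) this

/-- A function of the present state is a version of the conditional probability if it has the
right integrals. -/
theorem condExp_indicator_ae_eq {P : Measure (Fin (n + 1) → 𝒳)} [IsProbabilityMeasure P]
    {t : Fin (n + 1)} {A : Set (Fin (n + 1) → 𝒳)} (hA : MeasurableSet A) {α : 𝒳 → ℝ≥0∞}
    (hα : Measurable α)
    (h : ∀ C, MeasurableSet C → P (A ∩ (fun x => x t) ⁻¹' C) =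
      ∫⁻ x in (fun x => x t) ⁻¹' C, α (x t) ∂P) :
    P⟦A | present t⟧ =ᵐ[P] fun x => (α (x t)).toReal := by
  have hm : Measurable fun x : Fin (n + 1) → 𝒳 => α (x t) := by fun_prop
  have hfin : ∫⁻ x, α (x t) ∂P ≠ ∞ := by
    have := h Set.univ MeasurableSet.univ
    simp only [Set.preimage_univ, Set.inter_univ, Measure.restrict_univ] at this
    rw [← this]; exact measure_ne_top _ _
  have hint : Integrable (fun x => (α (x t)).toReal) P :=
    integrable_toReal_of_lintegral_ne_top hm.aemeasurable hfin
  refine (ae_eq_condExp_of_forall_setIntegral_eq (present_le t)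
    ((integrable_const (1 : ℝ)).indicator hA) (fun s _ _ => hint.integrableOn) ?_ ?_).symm
  · rintro _ ⟨C, hC, rfl⟩ -
    rw [integral_toReal hm.aemeasurable
      (ae_restrict_of_ae (ae_lt_top hm hfin)), ← h C hC, integral_indicator hA,
      integral_const]
    simp [measureReal_def, Measure.restrict_apply, hA]
  · have : Measurable[present t] fun x : Fin (n + 1) → 𝒳 => (α (x t)).toReal :=
      (hα.ennreal_toReal).comp (comap_measurable _)
    exact this.aestronglyMeasurable

/-! ### Stationary Markov chains with a given pair density -/

variable (π : Measure 𝒳) [IsProbabilityMeasure π]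

/-- A joint density with respect to `π × π` of a bivariate law with marginals `π`. -/
structure IsCopulaDensity (g : 𝒳 × 𝒳 → ℝ≥0∞) : Prop where
  measurable : Measurable g
  lintegral_fst : ∀ᵐ x ∂π, ∫⁻ y, g (x, y) ∂π = 1
  lintegral_snd : ∀ᵐ y ∂π, ∫⁻ x, g (x, y) ∂π = 1

/-- The law of the stationary Markov chain with marginal law `π` whose consecutive states have
joint density `g` with respect to `π × π`. -/
def chainLaw (n : ℕ) (g : 𝒳 × 𝒳 → ℝ≥0∞) : Measure (Fin (n + 1) → 𝒳) :=
  (baseline π n).withDensity (chain (fun _ => g) 0 n)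

variable {π} {g : 𝒳 × 𝒳 → ℝ≥0∞}

theorem lintegral_chainLaw (hg : Measurable g) {f : (Fin (n + 1) → 𝒳) → ℝ≥0∞}
    (hf : Measurable f) :
    ∫⁻ x, f x ∂(chainLaw π n g) = ∫⁻ x, f x * chain (fun _ => g) 0 n x ∂(baseline π n) := by
  rw [chainLaw, lintegral_withDensity_eq_lintegral_mul _ (measurable_chain (fun _ => hg) _ _) hf]
  simp only [Pi.mul_apply, mul_comm]

theorem lintegral_mul_pair_succ_of_isCopulaDensity (hg : IsCopulaDensity π g) {i : Fin n}
    {f : (Fin (n + 1) → 𝒳) → ℝ≥0∞} (hf : Measurable f) (hfS : DependsOn f {i.succ}ᶜ) :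
    ∫⁻ x, f x * g (x i.castSucc, x i.succ) ∂(baseline π n) = ∫⁻ x, f x ∂(baseline π n) := by
  rw [lintegral_mul_pair_succ π hf hg.measurable hfS]
  refine lintegral_congr_ae ?_
  filter_upwards [(measurePreserving_eval_baseline π i.castSucc).quasiMeasurePreserving.ae
    hg.lintegral_fst] with x hx
  rw [hx, mul_one]

theorem lintegral_mul_pair_castSucc_of_isCopulaDensity (hg : IsCopulaDensity π g) {i : Fin n}
    {f : (Fin (n + 1) → 𝒳) → ℝ≥0∞} (hf : Measurable f) (hfS : DependsOn f {i.castSucc}ᶜ) :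
    ∫⁻ x, f x * g (x i.castSucc, x i.succ) ∂(baseline π n) = ∫⁻ x, f x ∂(baseline π n) := by
  rw [lintegral_mul_pair_castSucc π hf hg.measurable hfS]
  refine lintegral_congr_ae ?_
  filter_upwards [(measurePreserving_eval_baseline π i.succ).quasiMeasurePreserving.ae
    hg.lintegral_snd] with x hx
  rw [hx, mul_one]

/-- Transitions outside a block of times can be integrated out. -/
theorem lintegral_mul_chain_eq (hg : IsCopulaDensity π g) {a b : ℕ} (hab : a ≤ b) (hbn : b ≤ n)
    {f : (Fin (n + 1) → 𝒳) → ℝ≥0∞} (hf : Measurable f)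
    (hfS : DependsOn f {j | a ≤ j.val ∧ j.val ≤ b}) :
    ∫⁻ x, f x * chain (fun _ => g) 0 n x ∂(baseline π n) =
      ∫⁻ x, f x * chain (fun _ => g) a b x ∂(baseline π n) := by
  have hmc : ∀ u v, Measurable (chain (fun _ : Fin n => g) u v) :=
    fun u v => measurable_chain (fun _ => hg.measurable) u v
  -- Transitions after `b` are peeled off from the end: the final state occurs in no other factor,
  -- and g integrates to 1 in its second variable.
  have right : ∀ u, b ≤ u → u ≤ n → ∫⁻ x, f x * chain (fun _ => g) 0 u x ∂(baseline π n) =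
      ∫⁻ x, f x * chain (fun _ => g) 0 b x ∂(baseline π n) := by
    intro u hu
    induction u, hu using Nat.le_induction with
    | base => exact fun _ => rfl
    | succ u hu ih =>
      intro hun
      rw [← ih (by omega)]
      have h1 := fun x => chain_succ_right (𝒳 := 𝒳) (fun _ : Fin n => g) (a := 0) ⟨u, by omega⟩
        (Nat.zero_le _) x
      simp only [h1, ← mul_assoc]
      refine lintegral_mul_pair_succ_of_isCopulaDensity hg (hf.mul (hmc _ _)) fun x y hxy => ?_
      have e1 : f x = f y := hfS fun j hj => hxy j (by
        simp only [Set.mem_compl_iff, Set.mem_singleton_iff, Fin.ext_iff, Fin.val_succ]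
        have := hj.2; omega)
      have e2 := dependsOn_chain (fun _ : Fin n => g) 0 u (x := x) (y := y) fun j hj => hxy j (by
        simp only [Set.mem_compl_iff, Set.mem_singleton_iff, Fin.ext_iff, Fin.val_succ]
        have := hj.2; omega)
      simp only [e1, e2]
  -- Transitions before `a` are peeled off from the start, using the other marginal condition.
  have left : ∀ v, v ≤ a → ∫⁻ x, f x * chain (fun _ => g) 0 b x ∂(baseline π n) =
      ∫⁻ x, f x * chain (fun _ => g) v b x ∂(baseline π n) := by
    intro v
    induction v with
    | zero => exact fun _ => rfl
    | succ v ih =>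
      intro hva
      rw [ih (by omega)]
      have h1 := fun x => chain_succ_left (𝒳 := 𝒳) (fun _ : Fin n => g) (b := b) ⟨v, by omega⟩
        (by simp; omega) x
      simp only [h1, ← mul_assoc]
      refine lintegral_mul_pair_castSucc_of_isCopulaDensity hg (hf.mul (hmc _ _)) fun x y hxy => ?_
      have e1 : f x = f y := hfS fun j hj => hxy j (by
        simp only [Set.mem_compl_iff, Set.mem_singleton_iff, Fin.ext_iff, Fin.val_castSucc]
        have := hj.1; omega)
      have e2 := dependsOn_chain (fun _ : Fin n => g) (v + 1) b (x := x) (y := y)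
        fun j hj => hxy j (by
          simp only [Set.mem_compl_iff, Set.mem_singleton_iff, Fin.ext_iff, Fin.val_castSucc]
          have := hj.1; omega)
      simp only [e1, e2]
  rw [right n hbn le_rfl, left a le_rfl]

theorem isProbabilityMeasure_chainLaw (hg : IsCopulaDensity π g) :
    IsProbabilityMeasure (chainLaw π n g) := by
  constructor
  have h1 := lintegral_chainLaw (π := π) (n := n) hg.measurable (f := fun _ => 1) measurable_const
  rw [lintegral_mul_chain_eq hg le_rfl (Nat.zero_le _) measurable_const
    (fun _ _ _ => rfl)] at h1
  simpa [chain_self] using h1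

theorem map_block_baseline (π : Measure 𝒳) [IsProbabilityMeasure π] {m k : ℕ}
    (hmk : m + (k + 1) ≤ n + 1) :
    (baseline π n).map (fun x (i : Fin (k + 1)) => x ⟨m + i, by omega⟩) = baseline π k := by
  have h1 : iIndepFun (fun (j : Fin (n + 1)) (x : Fin (n + 1) → 𝒳) => x j) (baseline π n) :=
    iIndepFun_pi (X := fun _ x => x) fun _ => aemeasurable_id
  have hinj : Function.Injective (fun i : Fin (k + 1) => (⟨m + i, by omega⟩ : Fin (n + 1))) := by
    intro i j hij
    simp only [Fin.mk.injEq] at hij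
    exact Fin.ext (by omega)
  have h2 := h1.precomp hinj
  rw [iIndepFun_iff_map_fun_eq_pi_map (fun _ => (measurable_pi_apply _).aemeasurable)] at h2
  rw [h2, baseline]
  congr 1
  funext i
  exact (measurePreserving_eval_baseline π _).map_eq

/-- The law of a block of consecutive states. -/
theorem map_block_chainLaw (hg : IsCopulaDensity π g) {m k : ℕ} (hmk : m + (k + 1) ≤ n + 1) :
    (chainLaw π n g).map (fun x (i : Fin (k + 1)) => x ⟨m + i, by omega⟩) = chainLaw π k g := by
  set B : (Fin (n + 1) → 𝒳) → Fin (k + 1) → 𝒳 := fun x i => x ⟨m + i, by omega⟩ with hB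
  have hBm : Measurable B := measurable_pi_lambda _ fun i => measurable_pi_apply _
  have hchain : ∀ x, chain (fun _ : Fin n => g) m (m + k) x = chain (fun _ => g) 0 k (B x) := by
    intro x
    rw [chain_zero_eq_prod, chain]
    refine (Finset.prod_bij (fun i _ => (⟨m + i.val, by omega⟩ : Fin n)) ?_ ?_ ?_ ?_).symm
    · intro i _; simp
    · intro i _ j _ hij
      simp only [Fin.mk.injEq] at hij
      exact Fin.ext (by omega)
    · intro j hj
      simp only [Finset.mem_filter, Finset.mem_univ, true_and] at hj
      exact ⟨⟨j.val - m, by omega⟩, Finset.mem_univ _, Fin.ext (by simp; omega)⟩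
    · intro i _; rfl
  ext S hS
  have hind : Measurable ((B ⁻¹' S).indicator fun _ => (1 : ℝ≥0∞)) :=
    measurable_const.indicator (hBm hS)
  have hind' : Measurable (S.indicator fun _ => (1 : ℝ≥0∞)) := measurable_const.indicator hS
  rw [Measure.map_apply hBm hS, ← lintegral_indicator_one (hBm hS), ← lintegral_indicator_one hS]
  simp only [Pi.one_def]
  rw [lintegral_chainLaw hg.measurable hind, lintegral_chainLaw hg.measurable hind',
    lintegral_mul_chain_eq hg (a := m) (b := m + k) (by omega) (by omega) hind,
    ← map_block_baseline π hmk,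
    lintegral_map (f := fun x => S.indicator (fun _ => 1) x * chain (fun _ => g) 0 k x)
      (hind'.mul (measurable_chain (fun _ => hg.measurable) _ _)) hBm]
  · refine lintegral_congr fun x => ?_
    rw [hchain]; rfl
  · intro x y hxy
    have : B x = B y := funext fun i => hxy _ (by simp; omega)
    exact congrArg (S.indicator fun _ => (1 : ℝ≥0∞)) this

theorem isStationary_chainLaw (hg : IsCopulaDensity π g) : IsStationary (chainLaw π n g) := by
  intro m k hmk
  -- `chainLaw π k g` lives on k + 1 states, so the empty block has to be treated apart.
  cases k with
  | zero => congr 1; funext x i; exact i.elim0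
  | succ k =>
    rw [map_block_chainLaw hg hmk]
    have := map_block_chainLaw (π := π) (n := n) hg (m := 0) (k := k) (by omega)
    simpa using this.symm

theorem map_eval_chainLaw (hg : IsCopulaDensity π g) (t : Fin (n + 1)) :
    (chainLaw π n g).map (fun x => x t) = π := by
  ext S hS
  have hp : MeasurableSet ((fun x : Fin (n + 1) → 𝒳 => x t) ⁻¹' S) := measurable_pi_apply t hS
  have hind : Measurable (((fun x : Fin (n + 1) → 𝒳 => x t) ⁻¹' S).indicator
    fun _ => (1 : ℝ≥0∞)) := measurable_const.indicator hp
  rw [Measure.map_apply (measurable_pi_apply t) hS, ← lintegral_indicator_one hp]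
  simp only [Pi.one_def]
  rw [lintegral_chainLaw hg.measurable hind,
    lintegral_mul_chain_eq hg (a := t.val) (b := t.val) le_rfl (by omega) hind]
  · simp only [chain_self, mul_one]
    have := lintegral_indicator_one (μ := baseline π n) hp
    simp only [Pi.one_def] at this
    rw [this, (measurePreserving_eval_baseline π t).measure_preimage hS.nullMeasurableSet]
  · intro x y hxy
    have : x t = y t := hxy t (by simp)
    exact congrArg (S.indicator fun _ => (1 : ℝ≥0∞)) this

theorem map_pair_chainLaw (hg : IsCopulaDensity π g) (i : Fin n) :
    (chainLaw π n g).map (fun x => (x i.castSucc, x i.succ)) = (π.prod π).withDensity g := by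
  have hm : Measurable fun x : Fin (n + 1) → 𝒳 => (x i.castSucc, x i.succ) := by fun_prop
  ext S hS
  have hind : Measurable (((fun x : Fin (n + 1) → 𝒳 => (x i.castSucc, x i.succ)) ⁻¹' S).indicator
    fun _ => (1 : ℝ≥0∞)) := measurable_const.indicator (hm hS)
  rw [Measure.map_apply hm hS, ← lintegral_indicator_one (hm hS), withDensity_apply _ hS,
    ← lintegral_indicator hS, ← (measurePreserving_pair π i).lintegral_comp
      (hg.measurable.indicator hS)]
  simp only [Pi.one_def]
  rw [lintegral_chainLaw hg.measurable hind,
    lintegral_mul_chain_eq hg (a := i.val) (b := i.val + 1) (by omega) (by omega) hind]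
  · refine lintegral_congr fun x => ?_
    rw [chain_succ_right _ i le_rfl, chain_self, one_mul]
    by_cases hx : (x i.castSucc, x i.succ) ∈ S <;> simp [Set.indicator, hx]
  · intro x y hxy
    have h1 : x i.castSucc = y i.castSucc := hxy _ (by simp)
    have h2 : x i.succ = y i.succ := hxy _ (by simp)
    exact congrArg (S.indicator fun _ => (1 : ℝ≥0∞)) (Prod.ext h1 h2)

/-- The density splits at time t into a factor W₁ of the states up to t and a factor W₂ of the
states from t on. Hence the conditional probability of A ∩ B given X_t = c is a product α_A(c)
β_B(c). Those of A and of B are α_A β_Ω and α_Ω β_B, with Ω the whole path space, and the factor α_Ω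
β_Ω by which the products differ equals 1 almost surely. -/
theorem isOneDependent_chainLaw (hg : IsCopulaDensity π g) :
    IsOneDependent (chainLaw π n g) := by
  intro t A B hA hB
  have := isProbabilityMeasure_chainLaw (n := n) hg
  set W₁ := chain (fun _ : Fin n => g) 0 t.val with hW₁
  set W₂ := chain (fun _ : Fin n => g) t.val n with hW₂
  have hW₁m : Measurable W₁ := measurable_chain (fun _ => hg.measurable) _ _
  have hW₂m : Measurable W₂ := measurable_chain (fun _ => hg.measurable) _ _
  let α : Set (Fin (n + 1) → 𝒳) → 𝒳 → ℝ≥0∞ := fun A =>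
    fiberMean π t fun x => A.indicator (fun _ => 1) x * W₁ x
  let β : Set (Fin (n + 1) → 𝒳) → 𝒳 → ℝ≥0∞ := fun B =>
    fiberMean π t fun x => B.indicator (fun _ => 1) x * W₂ x
  have hαm : ∀ A, MeasurableSet A → Measurable (α A) := fun A hA =>
    measurable_fiberMean π t ((measurable_const.indicator hA).mul hW₁m)
  have hβm : ∀ B, MeasurableSet B → Measurable (β B) := fun B hB =>
    measurable_fiberMean π t ((measurable_const.indicator hB).mul hW₂m)
  have hlaw : ∀ (φ : 𝒳 → ℝ≥0∞) (C : Set 𝒳), Measurable φ → MeasurableSet C →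
      ∫⁻ x in (fun x => x t) ⁻¹' C, φ (x t) ∂(chainLaw π n g) = ∫⁻ c in C, φ c ∂π := by
    intro φ C hφ hC
    conv_rhs => rw [← map_eval_chainLaw hg t]
    rw [setLIntegral_map hC hφ (measurable_pi_apply t)]
  have main : ∀ A B, MeasurableSet[past t] A → MeasurableSet[future t] B →
      ∀ C, MeasurableSet C → chainLaw π n g (A ∩ B ∩ (fun x => x t) ⁻¹' C) =
        ∫⁻ c in C, α A c * β B c ∂π := by
    intro A B hA hB C hC
    have hA' := past_le t A hA
    have hB' := future_le t B hB
    have hCt : MeasurableSet ((fun x : Fin (n + 1) → 𝒳 => x t) ⁻¹' C) := measurable_pi_apply t hC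
    have hABC := (hA'.inter hB').inter hCt
    have hAd := dependsOn_indicator_of_measurableSet_iSup hA (1 : ℝ≥0∞)
    have hBd := dependsOn_indicator_of_measurableSet_iSup hB (1 : ℝ≥0∞)
    have hA1 : Measurable (A.indicator fun _ => (1 : ℝ≥0∞)) := measurable_const.indicator hA'
    have hB1 : Measurable (B.indicator fun _ => (1 : ℝ≥0∞)) := measurable_const.indicator hB'
    have hC1 : Measurable (C.indicator fun _ => (1 : ℝ≥0∞)) := measurable_const.indicator hC
    have e1 : chainLaw π n g (A ∩ B ∩ (fun x => x t) ⁻¹' C) =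
        ∫⁻ x, (A.indicator (fun _ => 1) x * W₁ x * C.indicator (fun _ => 1) (x t)) *
          (B.indicator (fun _ => 1) x * W₂ x) ∂(baseline π n) := by
      rw [← lintegral_indicator_one hABC]
      simp only [Pi.one_def]
      rw [lintegral_chainLaw hg.measurable (measurable_const.indicator hABC)]
      refine lintegral_congr fun x => ?_
      rw [← chain_mul_chain (fun _ => g) (Nat.zero_le t.val) (by omega : t.val ≤ n) x]
      by_cases h1 : x ∈ A <;> by_cases h2 : x ∈ B <;> by_cases h3 : x t ∈ C <;>
        simp [Set.indicator, h1, h2, h3, W₁, W₂]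
    -- The states after t are integrated out here, which produces β; those before t are integrated
    -- out in `e3`, which produces α.
    have e2 := lintegral_mul_eq_lintegral_mul_fiberMean π (S := {j | j.val ≤ t.val}) (t := t)
      (by simp)
      (f := fun x => A.indicator (fun _ => 1) x * W₁ x * C.indicator (fun _ => 1) (x t))
      (g := fun x => B.indicator (fun _ => 1) x * W₂ x)
      ((hA1.mul hW₁m).mul (hC1.comp (measurable_pi_apply t))) (hB1.mul hW₂m)
      (fun x y hxy => by
        have d1 := hAd (x := x) (y := y) fun j hj => hxy j (Fin.le_def.1 (le_of_lt hj))
        have d2 : W₁ x = W₁ y := dependsOn_chain _ _ _ fun j hj => hxy j hj.2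
        have d3 : x t = y t := hxy t (by simp)
        simp only [d1, d2, d3])
      (fun x y hxy => by
        have d0 : ∀ j : Fin (n + 1), t.val ≤ j.val → x j = y j := fun j hj => hxy j (by
          rcases hj.eq_or_lt with h | h
          · left; exact Fin.ext h.symm
          · right; simpa using h)
        have d1 := hBd (x := x) (y := y) fun j hj => d0 j (Fin.le_def.1 (le_of_lt hj))
        have d2 : W₂ x = W₂ y := dependsOn_chain _ _ _ fun j hj => d0 j hj.1
        simp only [d1, d2])
    have e3 := lintegral_mul_eq_lintegral_mul_fiberMean π (S := {j | t.val ≤ j.val}) (t := t)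
      (by simp)
      (f := fun x => C.indicator (fun _ => 1) (x t) * β B (x t))
      (g := fun x => A.indicator (fun _ => 1) x * W₁ x)
      ((hC1.comp (measurable_pi_apply t)).mul ((hβm B hB').comp (measurable_pi_apply t)))
      (hA1.mul hW₁m)
      (fun x y hxy => by
        have d3 : x t = y t := hxy t (by simp)
        simp only [d3])
      (fun x y hxy => by
        have d0 : ∀ j : Fin (n + 1), j.val ≤ t.val → x j = y j := fun j hj => hxy j (by
          rcases hj.eq_or_lt with h | h
          · left; exact Fin.ext h
          · right; simpa using h)
        have d1 := hAd (x := x) (y := y) fun j hj => d0 j (Fin.le_def.1 (le_of_lt hj))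
        have d2 : W₁ x = W₁ y := dependsOn_chain _ _ _ fun j hj => d0 j hj.2
        simp only [d1, d2])
    rw [e1, e2, ← lintegral_indicator hC, ← (measurePreserving_eval_baseline π t).lintegral_comp
      (f := C.indicator fun c => α A c * β B c) (((hαm A hA').mul (hβm B hB')).indicator hC)]
    refine Eq.trans (lintegral_congr fun x => ?_) (e3.trans (lintegral_congr fun x => ?_))
    · simp only [β]; ring
    · by_cases h3 : x t ∈ C <;> simp [Set.indicator, h3, α, mul_comm]
  have hu₁ : MeasurableSet[past t] (Set.univ : Set (Fin (n + 1) → 𝒳)) := MeasurableSet.univ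
  have hu₂ : MeasurableSet[future t] (Set.univ : Set (Fin (n + 1) → 𝒳)) := MeasurableSet.univ
  have hcond : ∀ A B, MeasurableSet[past t] A → MeasurableSet[future t] B →
      (chainLaw π n g)⟦A ∩ B | present t⟧ =ᵐ[chainLaw π n g]
        fun x => (α A (x t) * β B (x t)).toReal := by
    intro A B hA hB
    have hm : Measurable fun c => α A c * β B c :=
      (hαm A (past_le t A hA)).mul (hβm B (future_le t B hB))
    refine condExp_indicator_ae_eq ((past_le t A hA).inter (future_le t B hB))
      (α := fun c => α A c * β B c) hm fun C hC => ?_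
    rw [main A B hA hB C hC, hlaw _ C hm hC]
  -- With trivial past and future events, `main` computes the law of X_t, which is π.
  have hone : ∀ᵐ c ∂π, α Set.univ c * β Set.univ c = 1 := by
    refine ae_eq_of_forall_setLIntegral_eq_of_sigmaFinite
      ((hαm _ MeasurableSet.univ).mul (hβm _ MeasurableSet.univ)) measurable_const
      fun C hC _ => ?_
    have h1 := main _ _ hu₁ hu₂ C hC
    rw [Set.univ_inter, Set.univ_inter, ← Measure.map_apply (measurable_pi_apply t) hC,
      map_eval_chainLaw hg t] at h1
    simp [← h1]
  have hone' : ∀ᵐ x ∂(chainLaw π n g), α Set.univ (x t) * β Set.univ (x t) = 1 := by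
    rw [← map_eval_chainLaw hg t] at hone
    exact ae_of_ae_map (measurable_pi_apply t).aemeasurable hone
  have hcA := hcond A Set.univ hA hu₂
  have hcB := hcond Set.univ B hu₁ hB
  rw [Set.inter_univ] at hcA
  rw [Set.univ_inter] at hcB
  filter_upwards [hcond A B hA hB, hcA, hcB, hone'] with x h1 h2 h3 h4
  rw [h1, Pi.mul_apply, h2, h3, ← ENNReal.toReal_mul]
  congr 1
  calc α A (x t) * β B (x t) = α A (x t) * β B (x t) * 1 := by rw [mul_one]
    _ = _ := by rw [← h4]; ring

/-- The `φ²`-coefficient of a bivariate law with marginals `π` and density `g`. -/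
theorem phiSq_withDensity (hg : IsCopulaDensity π g) :
    phiSq ((π.prod π).withDensity g) =
      ∫⁻ p, ENNReal.ofReal (((g p).toReal - 1) ^ 2) ∂(π.prod π) := by
  have h1 : ((π.prod π).withDensity g).map Prod.fst = π := by
    ext S hS
    rw [Measure.map_apply measurable_fst hS, withDensity_apply _ (measurable_fst hS),
      ← lintegral_indicator (measurable_fst hS),
      lintegral_prod _ (hg.measurable.indicator (measurable_fst hS)).aemeasurable,
      ← lintegral_indicator_one hS]
    refine lintegral_congr_ae ?_
    filter_upwards [hg.lintegral_fst] with x hx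
    by_cases h : x ∈ S <;> simp [Set.indicator, h, hx]
  have h2 : ((π.prod π).withDensity g).map Prod.snd = π := by
    ext S hS
    rw [Measure.map_apply measurable_snd hS, withDensity_apply _ (measurable_snd hS),
      ← lintegral_indicator (measurable_snd hS),
      lintegral_prod_symm _ (hg.measurable.indicator (measurable_snd hS)).aemeasurable,
      ← lintegral_indicator_one hS]
    refine lintegral_congr_ae ?_
    filter_upwards [hg.lintegral_snd] with x hx
    by_cases h : x ∈ S <;> simp [Set.indicator, h, hx]
  rw [phiSq, h1, h2, chiSq, if_pos (withDensity_absolutelyContinuous _ _)]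
  refine lintegral_congr_ae ?_
  filter_upwards [Measure.rnDeriv_withDensity (π.prod π) hg.measurable] with p hp
  rw [hp]

theorem feasible_chainLaw (hg : IsCopulaDensity π g) {η : ℝ}
    (hη : ∫⁻ p, ENNReal.ofReal (((g p).toReal - 1) ^ 2) ∂(π.prod π) ≤ ENNReal.ofReal η) :
    Feasible π η (chainLaw π n g) where
  isProbabilityMeasure := isProbabilityMeasure_chainLaw hg
  phiSq_le i := by rwa [map_pair_chainLaw hg, phiSq_withDensity hg]
  isOneDependent := isOneDependent_chainLaw hg
  isStationary := isStationary_chainLaw hg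
  marginal := map_eval_chainLaw hg
  absolutelyContinuous := withDensity_absolutelyContinuous _ _

end ChainLaw

/-! ### Feasible laws are Markov chains -/

section Feasible

variable {n : ℕ}

/-- In a `1`-dependent process, the conditional probability of a future event given the present is
also its conditional probability given present and past. -/
theorem IsOneDependent.measure_inter_inter_eq {P : Measure (Fin (n + 1) → 𝒳)}
    [IsProbabilityMeasure P] (hP : IsOneDependent P) {t : Fin (n + 1)}
    {A B : Set (Fin (n + 1) → 𝒳)} (hA : MeasurableSet[past t] A) (hB : MeasurableSet[future t] B)
    {b : 𝒳 → ℝ≥0∞} (hb : Measurable b)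
    (h : ∀ C, MeasurableSet C → P (B ∩ (fun x => x t) ⁻¹' C) =
      ∫⁻ x in (fun x => x t) ⁻¹' C, b (x t) ∂P) {C : Set 𝒳} (hC : MeasurableSet C) :
    P (A ∩ B ∩ (fun x => x t) ⁻¹' C) = ∫⁻ x in A ∩ (fun x => x t) ⁻¹' C, b (x t) ∂P := by
  have hA' := past_le t A hA
  have hB' := future_le t B hB
  have hC' : MeasurableSet[present t] ((fun x : Fin (n + 1) → 𝒳 => x t) ⁻¹' C) := ⟨C, hC, rfl⟩
  have hC'' := present_le t _ hC'
  have hm : Measurable fun x : Fin (n + 1) → 𝒳 => b (x t) := by fun_prop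
  have hfin : ∫⁻ x, b (x t) ∂P ≠ ∞ := by
    have := h Set.univ MeasurableSet.univ
    simp only [Set.preimage_univ, Set.inter_univ, Measure.restrict_univ] at this
    rw [← this]; exact measure_ne_top _ _
  have hfin' : ∀ s : Set (Fin (n + 1) → 𝒳), ∫⁻ x in s, b (x t) ∂P ≠ ∞ := fun s =>
    ((setLIntegral_le_lintegral s _).trans_lt hfin.lt_top).ne
  have hint : Integrable (fun x => (b (x t)).toReal) P :=
    integrable_toReal_of_lintegral_ne_top hm.aemeasurable hfin
  have hbm : StronglyMeasurable[present t] fun x : Fin (n + 1) → 𝒳 => (b (x t)).toReal := by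
    have : Measurable[present t] fun x : Fin (n + 1) → 𝒳 => (b (x t)).toReal :=
      hb.ennreal_toReal.comp (comap_measurable _)
    exact this.stronglyMeasurable
  have hprod : (A.indicator fun _ => (1 : ℝ)) * (fun x => (b (x t)).toReal) =
      A.indicator fun x => (b (x t)).toReal := by
    funext x
    by_cases hx : x ∈ A <;> simp [hx]
  have hintA : Integrable (A.indicator fun x => (b (x t)).toReal) P := hint.indicator hA'
  have hone : Integrable (A.indicator fun _ => (1 : ℝ)) P := (integrable_const _).indicator hA'
  have hpull := condExp_mul_of_stronglyMeasurable_right (μ := P) (m := present t)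
    (f := A.indicator fun _ => (1 : ℝ)) hbm (by rw [hprod]; exact hintA) hone
  rw [hprod] at hpull
  -- One-dependence factors the left side as P(A | X_t) b(X_t), and b(X_t), being a function of the
  -- present, can be moved inside the conditional expectation.
  have hcond : P⟦A ∩ B | present t⟧ =ᵐ[P] P[A.indicator fun x => (b (x t)).toReal | present t] := by
    filter_upwards [hP t A B hA hB, condExp_indicator_ae_eq hB' hb h, hpull] with x h1 h2 h3
    rw [h1, h3, Pi.mul_apply, Pi.mul_apply, h2]
  have e1 := setIntegral_condExp (μ := P) (present_le t)
    ((integrable_const (1 : ℝ)).indicator (hA'.inter hB')) hC'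
  have e2 := setIntegral_condExp (μ := P) (present_le t) hintA hC'
  rw [setIntegral_congr_ae hC'' (hcond.mono fun x hx _ => hx), e2] at e1
  rw [setIntegral_indicator hA', setIntegral_indicator (hA'.inter hB'), setIntegral_const,
    smul_eq_mul, mul_one, integral_toReal hm.aemeasurable
      (ae_restrict_of_ae (ae_lt_top hm hfin)), measureReal_def,
    ENNReal.toReal_eq_toReal_iff' (hfin' _) (measure_ne_top _ _)] at e1
  rw [Set.inter_comm A (_ ⁻¹' C), e1, Set.inter_comm (A ∩ B)]

variable {π : Measure 𝒳} [IsProbabilityMeasure π]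

/-- One-dependence is the Markov property, and a Markov law is determined by its initial law and the
laws of consecutive pairs. Both measures are compared on measurable rectangles, adding one state at
a time; no transition kernels are needed, as the pair density supplies the conditional
probabilities. -/
theorem eq_chainLaw_of_isOneDependent {P : Measure (Fin (n + 1) → 𝒳)} [IsProbabilityMeasure P]
    (hP : IsOneDependent P) (hmarg : ∀ t, P.map (fun x => x t) = π) {g : 𝒳 × 𝒳 → ℝ≥0∞}
    (hg : IsCopulaDensity π g)
    (hpair : ∀ i : Fin n, P.map (fun x => (x i.castSucc, x i.succ)) = (π.prod π).withDensity g) :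
    P = chainLaw π n g := by
  classical
  have := isProbabilityMeasure_chainLaw (n := n) hg
  have hchm : ∀ a b, Measurable (chain (fun _ : Fin n => g) a b) := fun a b =>
    measurable_chain (fun _ => hg.measurable) a b
  refine ext_of_generate_finite _ generateFrom_pi.symm isPiSystem_pi ?_ (by simp)
  rintro _ ⟨A, hA, rfl⟩
  have hA : ∀ j, MeasurableSet (A j) := fun j => hA j (Set.mem_univ j)
  set cyl : ℕ → Set (Fin (n + 1) → 𝒳) := fun t => {x | ∀ j : Fin (n + 1), j.val < t → x j ∈ A j}
    with hcyl
  have hcylp : ∀ t : Fin (n + 1), MeasurableSet[past t] (cyl t.val) := fun t => by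
    have : cyl t.val = ⋂ j : Fin (n + 1), ⋂ _ : j.val < t.val, (fun x => x j) ⁻¹' (A j) := by
      ext x; simp [hcyl]
    rw [this]
    refine MeasurableSet.iInter fun j => MeasurableSet.iInter fun hj => ?_
    exact le_iSup (fun s : {s : Fin (n + 1) // s < t} => present (𝒳 := 𝒳) s.1) ⟨j, hj⟩ _
      ⟨A j, hA j, rfl⟩
  have hcylm : ∀ t : Fin (n + 1), MeasurableSet (cyl t.val) := fun t => past_le t _ (hcylp t)
  -- The rectangle constrains only the states strictly before t, leaving the law of X_t free to be
  -- integrated against in the next step. The density stops at t as well, so later transitions never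
  -- have to be integrated out.
  have claim : ∀ (t : ℕ) (ht : t < n + 1),
      (P.restrict (cyl t)).map (fun x => x ⟨t, ht⟩) =
        (((baseline π n).withDensity (chain (fun _ => g) 0 t)).restrict (cyl t)).map
          (fun x => x ⟨t, ht⟩) := by
    intro t
    induction t with
    | zero =>
      intro ht
      have h1 : cyl 0 = Set.univ := by ext x; simp [hcyl]
      have h2 : chain (fun _ : Fin n => g) 0 0 = 1 := funext fun x => chain_self _ _ x
      rw [h1, Measure.restrict_univ, Measure.restrict_univ, h2, withDensity_one, hmarg,
        (measurePreserving_eval_baseline π _).map_eq]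
    | succ t ih =>
      intro ht
      have ih := ih (by omega)
      set i : Fin n := ⟨t, by omega⟩ with hi
      have hic : (⟨t, by omega⟩ : Fin (n + 1)) = i.castSucc := rfl
      have his : (⟨t + 1, ht⟩ : Fin (n + 1)) = i.succ := rfl
      rw [hic] at ih
      rw [his]
      ext B hB
      -- The conditional probability that the next state lies in `B`, given the present state c.
      set b : 𝒳 → ℝ≥0∞ := fun c => ∫⁻ y, B.indicator (fun _ => 1) y * g (c, y) ∂π with hb
      have hk : Measurable fun p : 𝒳 × 𝒳 => B.indicator (fun _ => (1 : ℝ≥0∞)) p.2 * g p :=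
        ((measurable_const.indicator hB).comp measurable_snd).mul hg.measurable
      have hbm : Measurable b := hk.lintegral_prod_right'
      have hBs : MeasurableSet ((fun x : Fin (n + 1) → 𝒳 => x i.succ) ⁻¹' B) :=
        measurable_pi_apply _ hB
      have hBf : MeasurableSet[future i.castSucc] ((fun x : Fin (n + 1) → 𝒳 => x i.succ) ⁻¹' B) :=
        le_iSup (fun s : {s : Fin (n + 1) // i.castSucc < s} => present (𝒳 := 𝒳) s.1)
          ⟨i.succ, Fin.castSucc_lt_succ⟩ _ ⟨B, hB, rfl⟩
      have hbC : ∀ C, MeasurableSet C →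
          P ((fun x => x i.succ) ⁻¹' B ∩ (fun x => x i.castSucc) ⁻¹' C) =
            ∫⁻ x in (fun x => x i.castSucc) ⁻¹' C, b (x i.castSucc) ∂P := by
        intro C hC
        have h1 : (fun x : Fin (n + 1) → 𝒳 => x i.succ) ⁻¹' B ∩ (fun x => x i.castSucc) ⁻¹' C =
            (fun x => (x i.castSucc, x i.succ)) ⁻¹' (C ×ˢ B) := by
          ext x; simp [and_comm]
        rw [h1, ← Measure.map_apply (by fun_prop) (hC.prod hB), hpair, withDensity_apply _
          (hC.prod hB), ← lintegral_indicator (hC.prod hB),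
          lintegral_prod _ (hg.measurable.indicator (hC.prod hB)).aemeasurable,
          ← setLIntegral_map hC hbm (measurable_pi_apply _), hmarg, ← lintegral_indicator hC]
        refine lintegral_congr fun c => ?_
        by_cases hc : c ∈ C
        · simp only [Set.indicator_of_mem hc, hb]
          refine lintegral_congr fun y => ?_
          by_cases hy : y ∈ B <;> simp [Set.indicator, hc, hy]
        · simp [Set.indicator, hc]
      have hcs : cyl (t + 1) = cyl t ∩ (fun x => x i.castSucc) ⁻¹' (A i.castSucc) := by
        ext x
        simp only [hcyl, Set.mem_ofPred_eq, Set.mem_inter_iff, Set.mem_preimage]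
        refine ⟨fun hx => ⟨fun j hj => hx j (by omega), hx _ (by simp [hi])⟩,
          fun ⟨hx, hx'⟩ j hj => ?_⟩
        rcases (Nat.lt_succ_iff.1 hj).lt_or_eq with h | h
        · exact hx j h
        · have : j = i.castSucc := Fin.ext h
          rwa [this]
      have hct : MeasurableSet (cyl t) := hcylm i.castSucc
      have hAi : MeasurableSet ((fun x : Fin (n + 1) → 𝒳 => x i.castSucc) ⁻¹' (A i.castSucc)) :=
        measurable_pi_apply _ (hA _)
      have hct' : MeasurableSet (cyl (t + 1)) := by rw [hcs]; exact hct.inter hAi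
      have hset : ∀ ν : Measure (Fin (n + 1) → 𝒳),
          ∫⁻ x in cyl t ∩ (fun x => x i.castSucc) ⁻¹' (A i.castSucc), b (x i.castSucc) ∂ν =
            ∫⁻ c in A i.castSucc, b c ∂((ν.restrict (cyl t)).map fun x => x i.castSucc) :=
        fun ν => by
          rw [setLIntegral_map (hA _) hbm (measurable_pi_apply _), Measure.restrict_restrict hAi,
            Set.inter_comm]
      rw [Measure.map_apply (measurable_pi_apply _) hB, Measure.map_apply (measurable_pi_apply _)
        hB, Measure.restrict_apply hBs, Measure.restrict_apply hBs]
      have e1 : P ((fun x => x i.succ) ⁻¹' B ∩ cyl (t + 1)) =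
          ∫⁻ x in cyl t ∩ (fun x => x i.castSucc) ⁻¹' (A i.castSucc), b (x i.castSucc) ∂P := by
        refine Eq.trans ?_ (hP.measure_inter_inter_eq (hcylp i.castSucc) hBf hbm hbC (hA _))
        rw [hcs]
        congr 1
        ext x
        simp only [Set.mem_inter_iff]
        exact ⟨fun h => ⟨⟨h.2.1, h.1⟩, h.2.2⟩, fun h => ⟨h.1.2, h.1.1, h.2⟩⟩
      rw [e1, hset, ih, ← hset, ← hcs, withDensity_apply _ (hBs.inter hct'),
        ← lintegral_indicator hct', ← lintegral_indicator (hBs.inter hct')]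
      have hbi : Measurable fun x : Fin (n + 1) → 𝒳 => b (x i.castSucc) :=
        hbm.comp (measurable_pi_apply _)
      rw [lintegral_withDensity_eq_lintegral_mul _ (hchm _ _) (hbi.indicator hct')]
      have e2 := lintegral_mul_pair_succ π (i := i)
        (f := fun x => (cyl (t + 1)).indicator (fun _ => 1) x * chain (fun _ => g) 0 t x)
        ((measurable_const.indicator hct').mul (hchm _ _)) hk (by
          intro x y hxy
          have d0 : ∀ j : Fin (n + 1), j.val ≤ t → x j = y j := fun j hj => hxy j (by
            simp only [Set.mem_compl_iff, Set.mem_singleton_iff, Fin.ext_iff, hi, Fin.val_succ]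
            omega)
          have d1 : chain (fun _ : Fin n => g) 0 t x = chain (fun _ => g) 0 t y :=
            dependsOn_chain _ _ _ fun j hj => d0 j hj.2
          have d2 : x ∈ cyl (t + 1) ↔ y ∈ cyl (t + 1) :=
            forall_congr' fun j => imp_congr_right fun hj => by rw [d0 j (by omega)]
          have d3 : (cyl (t + 1)).indicator (fun _ => (1 : ℝ≥0∞)) x =
              (cyl (t + 1)).indicator (fun _ => 1) y := by
            by_cases hy : y ∈ cyl (t + 1)
            · rw [Set.indicator_of_mem hy, Set.indicator_of_mem (d2.2 hy)]
            · rw [Set.indicator_of_notMem hy, Set.indicator_of_notMem (mt d2.1 hy)]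
          simp only [d1, d3])
      refine Eq.trans (lintegral_congr fun x => ?_) (e2.symm.trans (lintegral_congr fun x => ?_))
      · by_cases hx : x ∈ cyl (t + 1) <;> simp [Set.indicator, hx, hb]
      · have h1 := chain_succ_right (fun _ : Fin n => g) i (Nat.zero_le _) x
        have h2 : chain (fun _ : Fin n => g) 0 (t + 1) x = _ := h1
        rw [Set.indicator_apply (_ ∩ _), h2]
        by_cases hx : x ∈ cyl (t + 1) <;> simp [Set.indicator, hx, hi]
  have hfinal := congrArg (fun ν => ν (A (Fin.last n))) (claim n (by omega))
  have hln : (⟨n, by omega⟩ : Fin (n + 1)) = Fin.last n := rfl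
  have hAl : MeasurableSet ((fun x : Fin (n + 1) → 𝒳 => x (Fin.last n)) ⁻¹' (A (Fin.last n))) :=
    measurable_pi_apply _ (hA _)
  simp only [hln] at hfinal
  rw [Measure.map_apply (measurable_pi_apply _) (hA _), Measure.map_apply (measurable_pi_apply _)
    (hA _), Measure.restrict_apply hAl, Measure.restrict_apply hAl] at hfinal
  have hpi : Set.univ.pi A = (fun x : Fin (n + 1) → 𝒳 => x (Fin.last n)) ⁻¹' (A (Fin.last n)) ∩
      cyl n := by
    ext x
    simp only [hcyl, Set.mem_pi, Set.mem_univ, true_imp_iff, Set.mem_inter_iff, Set.mem_preimage,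
      Set.mem_ofPred_eq]
    refine ⟨fun hx => ⟨hx _, fun j _ => hx j⟩, fun ⟨hx, hx'⟩ j => ?_⟩
    rcases (Nat.lt_succ_iff.1 j.2).lt_or_eq with h | h
    · exact hx' j h
    · have : j = Fin.last n := Fin.ext h
      rwa [this]
  rw [hpi, hfinal, chainLaw]

/-- A feasible law is the law of a stationary Markov chain. -/
theorem Feasible.exists_eq_chainLaw {P : Measure (Fin (n + 1) → 𝒳)} {η : ℝ}
    (hP : Feasible π η P) (hn : 0 < n) :
    ∃ g, IsCopulaDensity π g ∧
      ∫⁻ p, ENNReal.ofReal (((g p).toReal - 1) ^ 2) ∂(π.prod π) ≤ ENNReal.ofReal η ∧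
      P = chainLaw π n g := by
  have := hP.isProbabilityMeasure
  set i₀ : Fin n := ⟨0, hn⟩
  set Q := P.map fun x => (x i₀.castSucc, x i₀.succ) with hQ
  have hpm : ∀ i : Fin n, Measurable fun x : Fin (n + 1) → 𝒳 => (x i.castSucc, x i.succ) :=
    fun i => by fun_prop
  have : IsProbabilityMeasure Q := Measure.isProbabilityMeasure_map (hpm i₀).aemeasurable
  -- Stationarity for blocks of length two gives a single density for all transitions.
  have hpair : ∀ i : Fin n, P.map (fun x => (x i.castSucc, x i.succ)) = Q := by
    have key : ∀ i : Fin n, P.map (fun x => (x i.castSucc, x i.succ)) =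
        (P.map fun x (j : Fin 2) => x ⟨j, by omega⟩).map fun f => (f 0, f 1) := by
      intro i
      have hm2 : Measurable fun f : Fin 2 → 𝒳 => (f 0, f 1) := by fun_prop
      have hm3 : Measurable fun (x : Fin (n + 1) → 𝒳) (j : Fin 2) =>
          x ⟨i.val + j.val, by omega⟩ := measurable_pi_lambda _ fun j => measurable_pi_apply _
      rw [← hP.isStationary i.val 2 (by omega), Measure.map_map hm2 hm3]
      rfl
    intro i
    rw [key i, hQ, key i₀]
  have hfst : Q.map Prod.fst = π := by
    rw [hQ, Measure.map_map measurable_fst (hpm i₀)]; exact hP.marginal _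
  have hsnd : Q.map Prod.snd = π := by
    rw [hQ, Measure.map_map measurable_snd (hpm i₀)]; exact hP.marginal _
  have hφ : chiSq Q (π.prod π) ≤ ENNReal.ofReal η := by
    have := hP.phiSq_le i₀
    rwa [← hQ, phiSq, hfst, hsnd] at this
  -- Otherwise `chiSq` would take its conventional value ∞, contrary to the bound η.
  have hac : Q ≪ π.prod π := by
    by_contra h
    rw [chiSq, if_neg h] at hφ
    exact absurd (top_le_iff.1 hφ) ENNReal.ofReal_ne_top
  rw [chiSq, if_pos hac] at hφ
  set g := Q.rnDeriv (π.prod π) with hgdef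
  have hgm : Measurable g := Measure.measurable_rnDeriv _ _
  have hQg : (π.prod π).withDensity g = Q := Measure.withDensity_rnDeriv_eq _ _ hac
  have hg : IsCopulaDensity π g := by
    refine ⟨hgm, ?_, ?_⟩
    · refine ae_eq_of_forall_setLIntegral_eq_of_sigmaFinite hgm.lintegral_prod_right'
        measurable_const fun C hC _ => ?_
      have h1 : ∫⁻ x in C, 1 ∂π = Q (Prod.fst ⁻¹' C) := by
        rw [setLIntegral_one, ← hfst, Measure.map_apply measurable_fst hC]
      rw [h1, ← hQg, withDensity_apply _ (measurable_fst hC),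
        ← lintegral_indicator (measurable_fst hC),
        lintegral_prod _ (hgm.indicator (measurable_fst hC)).aemeasurable, ← lintegral_indicator hC]
      refine lintegral_congr fun x => ?_
      by_cases h : x ∈ C <;> simp [Set.indicator, h]
    · refine ae_eq_of_forall_setLIntegral_eq_of_sigmaFinite hgm.lintegral_prod_left'
        measurable_const fun C hC _ => ?_
      have h1 : ∫⁻ x in C, 1 ∂π = Q (Prod.snd ⁻¹' C) := by
        rw [setLIntegral_one, ← hsnd, Measure.map_apply measurable_snd hC]
      rw [h1, ← hQg, withDensity_apply _ (measurable_snd hC),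
        ← lintegral_indicator (measurable_snd hC),
        lintegral_prod_symm _ (hgm.indicator (measurable_snd hC)).aemeasurable,
        ← lintegral_indicator hC]
      refine lintegral_congr fun x => ?_
      by_cases h : x ∈ C <;> simp [Set.indicator, h]
  exact ⟨g, hg, hφ, eq_chainLaw_of_isOneDependent hP.isOneDependent hP.marginal hg
    fun i => by rw [hpair, hQg]⟩

end Feasible

theorem enorm_sq_eq_lintegral {α : Type*} [MeasurableSpace α] {μ : Measure α} (f : Lp ℝ 2 μ) :
    ‖f‖ₑ ^ 2 = ∫⁻ a, ‖f a‖ₑ ^ 2 ∂μ := by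
  rw [Lp.enorm_def, eLpNorm_eq_lintegral_rpow_enorm_toReal (by norm_num) (by norm_num),
    ← ENNReal.rpow_two, ← ENNReal.rpow_mul]
  simp

section Functional

variable {n : ℕ} (π : Measure 𝒳) [IsProbabilityMeasure π]

/-! ### The objective as a polynomial on `L²` -/

theorem measurable_prod_pair {k : Fin n → 𝒳 × 𝒳 → ℝ} (hk : ∀ i, Measurable (k i)) :
    Measurable fun x : Fin (n + 1) → 𝒳 => ∏ i, k i (x i.castSucc, x i.succ) :=
  Finset.measurable_fun_prod _ fun i _ => (hk i).comp (by fun_prop)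

theorem measurable_coe_Lp {α : Type*} [MeasurableSpace α] {μ : Measure α} (f : Lp ℝ 2 μ) :
    Measurable f := (Lp.stronglyMeasurable f).measurable

theorem lintegral_enorm_prod_pair_le (k : Fin n → Lp ℝ 2 (π.prod π)) :
    ∫⁻ x, ‖∏ i, k i (x i.castSucc, x i.succ)‖ₑ ∂(baseline π n) ≤ ∏ i, ‖k i‖ₑ := by
  have h1 := sq_lintegral_prod_le π (k := fun i p => ‖k i p‖ₑ)
    fun i => (measurable_coe_Lp (k i)).enorm
  simp only [← enorm_sq_eq_lintegral, Finset.prod_pow] at h1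
  have h2 : ∀ x : Fin (n + 1) → 𝒳, ‖∏ i, k i (x i.castSucc, x i.succ)‖ₑ =
      ∏ i, ‖k i (x i.castSucc, x i.succ)‖ₑ := fun x => by
    simp only [← ofReal_norm, norm_prod]
    rw [ENNReal.ofReal_prod_of_nonneg fun i _ => norm_nonneg _]
  simp only [h2]
  exact (ENNReal.pow_le_pow_left_iff two_ne_zero).1 h1

theorem integrable_prod_pair (k : Fin n → Lp ℝ 2 (π.prod π)) :
    Integrable (fun x : Fin (n + 1) → 𝒳 => ∏ i, k i (x i.castSucc, x i.succ)) (baseline π n) := by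
  refine ⟨(measurable_prod_pair fun i => measurable_coe_Lp (k i)).aestronglyMeasurable,
    (lintegral_enorm_prod_pair_le π k).trans_lt ?_⟩
  exact ENNReal.prod_lt_top fun i _ => enorm_lt_top

theorem integral_norm_prod_pair_le (k : Fin n → Lp ℝ 2 (π.prod π)) :
    ∫ x, ‖∏ i, k i (x i.castSucc, x i.succ)‖ ∂(baseline π n) ≤ ∏ i, ‖k i‖ := by
  rw [integral_norm_eq_lintegral_enorm (integrable_prod_pair π k).1]
  refine ENNReal.toReal_le_of_le_ofReal (Finset.prod_nonneg fun _ _ => norm_nonneg _) ?_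
  rw [ENNReal.ofReal_prod_of_nonneg fun i _ => norm_nonneg _]
  simpa only [ofReal_norm] using lintegral_enorm_prod_pair_le π k

variable {h : (Fin (n + 1) → 𝒳) → ℝ} {C : ℝ}

theorem integrable_mul_of_bound {α : Type*} [MeasurableSpace α] {μ : Measure α} {f g : α → ℝ}
    (hf : Measurable f) (hC : ∀ a, |f a| ≤ C) (hg : Integrable g μ) :
    Integrable (fun a => f a * g a) μ :=
  hg.bdd_mul hf.aestronglyMeasurable (ae_of_all _ hC)

theorem prod_update_pair (k : Fin n → Lp ℝ 2 (π.prod π)) [DecidableEq (Fin n)] (i : Fin n)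
    (w : Lp ℝ 2 (π.prod π)) (x : Fin (n + 1) → 𝒳) :
    ∏ j, Function.update k i w j (x j.castSucc, x j.succ) =
      w (x i.castSucc, x i.succ) *
        ∏ j ∈ Finset.univ \ {i}, k j (x j.castSucc, x j.succ) := by
  rw [← Finset.prod_update_of_mem (Finset.mem_univ i)]
  refine Finset.prod_congr rfl fun j _ => ?_
  by_cases hj : j = i
  · subst hj; simp
  · simp [hj]

/-- The multilinear functional `k ↦ E₀[h(X) ∏ kᵢ(Xᵢ, Xᵢ₊₁)]` on `L²(π × π)ⁿ`. -/
def multilinearObjective (h_meas : Measurable h) (hC : ∀ x, |h x| ≤ C) :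
    ContinuousMultilinearMap ℝ (fun _ : Fin n => Lp ℝ 2 (π.prod π)) ℝ :=
  MultilinearMap.mkContinuous
    { toFun := fun k => ∫ x, h x * ∏ i, k i (x i.castSucc, x i.succ) ∂(baseline π n)
      map_update_add' := fun k i v w => by
        rw [← integral_add (integrable_mul_of_bound h_meas hC (integrable_prod_pair π _))
          (integrable_mul_of_bound h_meas hC (integrable_prod_pair π _))]
        refine integral_congr_ae ?_
        filter_upwards [(measurePreserving_pair π i).quasiMeasurePreserving.ae
          (Lp.coeFn_add v w)] with x hx
        rw [prod_update_pair, prod_update_pair, prod_update_pair, hx, Pi.add_apply]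
        ring
      map_update_smul' := fun k i c w => by
        rw [smul_eq_mul, ← integral_const_mul]
        refine integral_congr_ae ?_
        filter_upwards [(measurePreserving_pair π i).quasiMeasurePreserving.ae
          (Lp.coeFn_smul c w)] with x hx
        rw [prod_update_pair, prod_update_pair, hx, Pi.smul_apply, smul_eq_mul]
        ring }
    C fun k => by
      have hC0 : 0 ≤ C := by
        obtain ⟨x⟩ := nonempty_of_isProbabilityMeasure (baseline π n)
        exact (abs_nonneg _).trans (hC x)
      have h1 := integrable_prod_pair π k
      calc ‖∫ x, h x * ∏ i, k i (x i.castSucc, x i.succ) ∂(baseline π n)‖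
          ≤ ∫ x, ‖h x * ∏ i, k i (x i.castSucc, x i.succ)‖ ∂(baseline π n) :=
            norm_integral_le_integral_norm _
        _ ≤ ∫ x, C * ‖∏ i, k i (x i.castSucc, x i.succ)‖ ∂(baseline π n) := by
            refine integral_mono (integrable_mul_of_bound h_meas hC h1).norm
              (h1.norm.const_mul C) fun x => ?_
            rw [norm_mul]
            gcongr
            exact hC x
        _ ≤ C * ∏ i, ‖k i‖ := by
            rw [integral_const_mul]
            gcongr
            exact integral_norm_prod_pair_le π k

theorem multilinearObjective_apply (h_meas : Measurable h) (hC : ∀ x, |h x| ≤ C)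
    (k : Fin n → Lp ℝ 2 (π.prod π)) :
    multilinearObjective π h_meas hC k =
      ∫ x, h x * ∏ i, k i (x i.castSucc, x i.succ) ∂(baseline π n) := rfl

/-- The mean of `h` under the Markov chain whose transitions have joint density `1 + w`. -/
def objective (h : (Fin (n + 1) → 𝒳) → ℝ) (w : Lp ℝ 2 (π.prod π)) : ℝ :=
  ∫ x, h x * ∏ i : Fin n, (1 + w (x i.castSucc, x i.succ)) ∂(baseline π n)

/-- The objective is the restriction of a bounded multilinear form to the diagonal, translated by
the constant 1. It is thus a continuous polynomial on L², which is where its smoothness comes from.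
-/
theorem objective_eq_multilinearObjective (h_meas : Measurable h) (hC : ∀ x, |h x| ≤ C)
    (w : Lp ℝ 2 (π.prod π)) :
    objective π h w = multilinearObjective π h_meas hC fun _ => Lp.const 2 (π.prod π) 1 + w := by
  rw [multilinearObjective_apply, objective]
  refine integral_congr_ae ?_
  have h1 : ∀ᵐ p ∂(π.prod π), (Lp.const 2 (π.prod π) (1 : ℝ) + w) p = 1 + w p := by
    filter_upwards [Lp.coeFn_add (Lp.const 2 (π.prod π) (1 : ℝ)) w,
      Lp.coeFn_const 2 (π.prod π) (1 : ℝ)] with p h1 h2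
    rw [h1, Pi.add_apply, h2, Function.const_apply]
  have h2 : ∀ᵐ x ∂(baseline π n), ∀ i : Fin n,
      (Lp.const 2 (π.prod π) (1 : ℝ) + w) (x i.castSucc, x i.succ) =
        1 + w (x i.castSucc, x i.succ) :=
    ae_all_iff.2 fun i => (measurePreserving_pair π i).quasiMeasurePreserving.ae h1
  filter_upwards [h2] with x hx
  simp only [hx]

theorem contDiff_objective (h_meas : Measurable h) (hC : ∀ x, |h x| ≤ C) :
    ContDiff ℝ 2 (objective π h) := by
  have : objective π h = fun w => multilinearObjective π h_meas hC
      fun _ => Lp.const 2 (π.prod π) 1 + w :=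
    funext fun w => objective_eq_multilinearObjective π h_meas hC w
  rw [this]
  exact (multilinearObjective π h_meas hC).contDiff.comp
    (contDiff_pi.2 fun _ => contDiff_const.add contDiff_id)

/-- Product rule for a multilinear form: one factor at a time is replaced by w, the others stay at
their value 1. -/
theorem fderiv_objective_zero (h_meas : Measurable h) (hC : ∀ x, |h x| ≤ C)
    (w : Lp ℝ 2 (π.prod π)) :
    fderiv ℝ (objective π h) 0 w =
      ∑ i : Fin n, ∫ x, h x * w (x i.castSucc, x i.succ) ∂(baseline π n) := by
  have heq : objective π h = fun w => multilinearObjective π h_meas hC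
      fun _ => Lp.const 2 (π.prod π) 1 + w :=
    funext fun w => objective_eq_multilinearObjective π h_meas hC w
  have h1 : HasFDerivAt (fun (w : Lp ℝ 2 (π.prod π)) (_ : Fin n) => Lp.const 2 (π.prod π) 1 + w)
      (ContinuousLinearMap.pi fun _ => ContinuousLinearMap.id ℝ (Lp ℝ 2 (π.prod π))) 0 :=
    hasFDerivAt_pi.2 fun _ => (hasFDerivAt_id _).const_add _
  have h2 := ((multilinearObjective π h_meas hC).hasFDerivAt
    (fun _ => Lp.const 2 (π.prod π) 1 + 0)).comp (0 : Lp ℝ 2 (π.prod π)) h1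
  rw [heq]
  refine (congrArg (fun f => f w) h2.fderiv).trans ?_
  rw [ContinuousLinearMap.comp_apply, ContinuousMultilinearMap.linearDeriv_apply]
  refine Finset.sum_congr rfl fun i _ => ?_
  rw [multilinearObjective_apply]
  refine integral_congr_ae ?_
  have hc : ∀ᵐ p ∂(π.prod π), (Lp.const 2 (π.prod π) (1 : ℝ) + 0) p = 1 := by
    rw [add_zero]; exact Lp.coeFn_const 2 (π.prod π) (1 : ℝ)
  have h4 : ∀ᵐ x ∂(baseline π n), ∀ i : Fin n,
      (Lp.const 2 (π.prod π) (1 : ℝ) + 0) (x i.castSucc, x i.succ) = 1 :=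
    ae_all_iff.2 fun i => (measurePreserving_pair π i).quasiMeasurePreserving.ae hc
  filter_upwards [h4] with x hx
  rw [prod_update_pair, Finset.prod_eq_one fun j _ => hx j, mul_one]
  rfl

/-! ### Densities of feasible transitions -/

/-- The functions `w` such that `1 + w` is the joint density of a law with marginals `π`. -/
def densityDeviations : Set (Lp ℝ 2 (π.prod π)) :=
  {w | (∀ S, MeasurableSet S → -(π.prod π).real S ≤ ∫ p in S, w p ∂(π.prod π)) ∧
    (∀ C, MeasurableSet C → ∫ p in C ×ˢ Set.univ, w p ∂(π.prod π) = 0) ∧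
    ∀ C, MeasurableSet C → ∫ p in Set.univ ×ˢ C, w p ∂(π.prod π) = 0}

theorem integrable_coe_Lp (w : Lp ℝ 2 (π.prod π)) : Integrable w (π.prod π) :=
  (Lp.memLp w).integrable (by norm_num)

/-- Integration over S is the inner product with an indicator. Since `densityDeviations` is cut out
by such continuous functionals, its convexity and closedness are immediate. -/
theorem exists_setIntegral_eq {S : Set (𝒳 × 𝒳)} (hS : MeasurableSet S) :
    ∃ f : Lp ℝ 2 (π.prod π) →L[ℝ] ℝ, ∀ w, f w = ∫ p in S, w p ∂(π.prod π) :=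
  ⟨innerSL ℝ (indicatorConstLp 2 hS (measure_ne_top _ _) 1), fun w => by
    rw [innerSL_apply_apply, L2.inner_indicatorConstLp_one]⟩

theorem convex_densityDeviations : Convex ℝ (densityDeviations π) := by
  intro v hv w hw a b ha hb hab
  refine ⟨fun S hS => ?_, fun C hC => ?_, fun C hC => ?_⟩
  · obtain ⟨f, hf⟩ := exists_setIntegral_eq π hS
    have h1 := hv.1 S hS
    have h2 := hw.1 S hS
    rw [← hf] at h1 h2 ⊢
    rw [map_add, map_smul, map_smul, smul_eq_mul, smul_eq_mul]
    have h3 := mul_le_mul_of_nonneg_left h1 ha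
    have h4 := mul_le_mul_of_nonneg_left h2 hb
    have h5 : a * -(π.prod π).real S + b * -(π.prod π).real S = -(π.prod π).real S := by
      rw [← add_mul, hab, one_mul]
    linarith
  · obtain ⟨f, hf⟩ := exists_setIntegral_eq π (hC.prod MeasurableSet.univ)
    have h1 := hv.2.1 C hC
    have h2 := hw.2.1 C hC
    rw [← hf] at h1 h2 ⊢
    simp [h1, h2]
  · obtain ⟨f, hf⟩ := exists_setIntegral_eq π (MeasurableSet.univ.prod hC)
    have h1 := hv.2.2 C hC
    have h2 := hw.2.2 C hC
    rw [← hf] at h1 h2 ⊢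
    simp [h1, h2]

theorem isClosed_densityDeviations : IsClosed (densityDeviations π) := by
  have : densityDeviations π =
      (⋂ S, ⋂ _ : MeasurableSet S,
        {w | -(π.prod π).real S ≤ ∫ p in S, w p ∂(π.prod π)}) ∩
      ((⋂ C, ⋂ _ : MeasurableSet C, {w | ∫ p in C ×ˢ Set.univ, w p ∂(π.prod π) = 0}) ∩
        ⋂ C, ⋂ _ : MeasurableSet C, {w | ∫ p in Set.univ ×ˢ C, w p ∂(π.prod π) = 0}) := by
    ext w; simp [densityDeviations]
  rw [this]
  refine (isClosed_iInter fun S => isClosed_iInter fun hS => ?_).inter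
    ((isClosed_iInter fun C => isClosed_iInter fun hC => ?_).inter
      (isClosed_iInter fun C => isClosed_iInter fun hC => ?_))
  · obtain ⟨f, hf⟩ := exists_setIntegral_eq π hS
    simp only [← hf]
    exact isClosed_le continuous_const f.continuous
  · obtain ⟨f, hf⟩ := exists_setIntegral_eq π (hC.prod MeasurableSet.univ)
    simp only [← hf]
    exact isClosed_eq f.continuous continuous_const
  · obtain ⟨f, hf⟩ := exists_setIntegral_eq π (MeasurableSet.univ.prod hC)
    simp only [← hf]
    exact isClosed_eq f.continuous continuous_const

/-- An integrable function is determined, up to null sets and including its sign, by its integrals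
over measurable sets. This passes from the form suited to functional analysis to the one suited to
densities. -/
theorem mem_densityDeviations_iff {w : Lp ℝ 2 (π.prod π)} :
    w ∈ densityDeviations π ↔ (∀ᵐ p ∂(π.prod π), 0 ≤ 1 + w p) ∧
      (∀ᵐ x ∂π, ∫ y, w (x, y) ∂π = 0) ∧ ∀ᵐ y ∂π, ∫ x, w (x, y) ∂π = 0 := by
  have hw := integrable_coe_Lp π w
  have hw1 : Integrable (fun p => 1 + w p) (π.prod π) := (integrable_const 1).add hw
  have e0 : ∀ S, ∫ p in S, (1 + w p) ∂(π.prod π) =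
      (π.prod π).real S + ∫ p in S, w p ∂(π.prod π) := fun S => by
    rw [integral_add (integrable_const _).integrableOn hw.integrableOn]; simp
  have e1 : ∀ C, ∫ p in C ×ˢ Set.univ, w p ∂(π.prod π) = ∫ x in C, ∫ y, w (x, y) ∂π ∂π :=
    fun C => by rw [setIntegral_prod _ hw.integrableOn]; simp
  have e2 : ∀ C, ∫ p in Set.univ ×ˢ C, w p ∂(π.prod π) = ∫ y in C, ∫ x, w (x, y) ∂π ∂π :=
    fun C => by
      rw [← setIntegral_prod_swap, setIntegral_prod (fun p => w p.swap) hw.swap.integrableOn]; simp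
  refine and_congr ⟨fun hS => ?_, fun hS S hSm => ?_⟩ (and_congr ⟨fun hC => ?_, fun hC C hCm => ?_⟩
    ⟨fun hC => ?_, fun hC C hCm => ?_⟩)
  · refine ae_nonneg_of_forall_setIntegral_nonneg hw1 fun S hSm _ => ?_
    rw [e0]; linarith [hS S hSm]
  · have := setIntegral_nonneg_of_ae (s := S) hS
    rw [e0] at this
    linarith
  · refine hw.integral_prod_left.ae_eq_zero_of_forall_setIntegral_eq_zero fun C hCm _ => ?_
    rw [← e1, hC C hCm]
  · rw [e1]
    exact integral_eq_zero_of_ae (ae_restrict_of_ae hC)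
  · refine hw.integral_prod_right.ae_eq_zero_of_forall_setIntegral_eq_zero fun C hCm _ => ?_
    rw [← e2, hC C hCm]
  · rw [e2]
    exact integral_eq_zero_of_ae (ae_restrict_of_ae hC)

variable {π}

theorem isCopulaDensity_of_mem {w : Lp ℝ 2 (π.prod π)} (hw : w ∈ densityDeviations π) :
    IsCopulaDensity π fun p => ENNReal.ofReal (1 + w p) := by
  obtain ⟨h0, h1, h2⟩ := (mem_densityDeviations_iff π).1 hw
  have hint := integrable_coe_Lp π w
  refine ⟨((measurable_coe_Lp w).const_add 1).ennreal_ofReal, ?_, ?_⟩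
  · filter_upwards [h1, Measure.ae_ae_of_ae_prod h0, hint.prod_right_ae] with x hx hx0 hxi
    have hi : Integrable (fun y => 1 + w (x, y)) π := (integrable_const 1).add hxi
    rw [← ofReal_integral_eq_lintegral_ofReal hi hx0, integral_add (integrable_const _) hxi, hx]
    simp
  · have h0' : ∀ᵐ p ∂(π.prod π), 0 ≤ 1 + w p.swap :=
      (Measure.measurePreserving_swap (μ := π) (ν := π)).quasiMeasurePreserving.ae h0
    filter_upwards [h2, Measure.ae_ae_of_ae_prod h0', hint.prod_left_ae] with x hx hx0 hxi
    simp only [Prod.swap_prod_mk] at hx0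
    have hi : Integrable (fun y => 1 + w (y, x)) π := (integrable_const 1).add hxi
    rw [← ofReal_integral_eq_lintegral_ofReal hi hx0, integral_add (integrable_const _) hxi, hx]
    simp

theorem integral_chainLaw {g : 𝒳 × 𝒳 → ℝ≥0∞} (hg : IsCopulaDensity π g)
    (h : (Fin (n + 1) → 𝒳) → ℝ) :
    ∫ x, h x ∂(chainLaw π n g) =
      ∫ x, h x * ∏ i : Fin n, (g (x i.castSucc, x i.succ)).toReal ∂(baseline π n) := by
  have hm := measurable_chain (fun _ : Fin n => hg.measurable) 0 n
  have h1 : ∫⁻ x, chain (fun _ : Fin n => g) 0 n x ∂(baseline π n) ≠ ∞ := by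
    have := isProbabilityMeasure_chainLaw (n := n) hg
    have h2 := measure_univ (μ := chainLaw π n g)
    rw [chainLaw, withDensity_apply _ MeasurableSet.univ, Measure.restrict_univ] at h2
    simp [h2]
  rw [chainLaw, integral_withDensity_eq_integral_toReal_smul hm (ae_lt_top hm h1)]
  refine integral_congr_ae (ae_of_all _ fun x => ?_)
  simp only [chain_zero_eq_prod, ENNReal.toReal_prod, smul_eq_mul, mul_comm]

/-- The values attained by feasible laws, in terms of deviations of the density from `1`. -/
theorem objectiveValues_eq_image (h : (Fin (n + 1) → 𝒳) → ℝ) (hn : 0 < n) {η : ℝ} (hη : 0 ≤ η) :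
    objectiveValues π h η = objective π h '' {w | w ∈ densityDeviations π ∧ ‖w‖ ≤ √η} := by
  -- The φ²-coefficient of the density 1 + w is ‖w‖², so the budget η is a ball of radius √η.
  have hnorm : ∀ w : Lp ℝ 2 (π.prod π), ‖w‖ ≤ √η ↔
      ∫⁻ p, ENNReal.ofReal (w p ^ 2) ∂(π.prod π) ≤ ENNReal.ofReal η := by
    intro w
    have h1 : ∀ p, ENNReal.ofReal (w p ^ 2) = ‖w p‖ₑ ^ 2 := fun p => by
      rw [← ofReal_norm, ← ENNReal.ofReal_pow (norm_nonneg _), Real.norm_eq_abs, sq_abs]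
    simp only [h1, ← enorm_sq_eq_lintegral]
    rw [← ofReal_norm, ← ENNReal.ofReal_pow (norm_nonneg _),
      ENNReal.ofReal_le_ofReal_iff hη, Real.le_sqrt (norm_nonneg _) hη]
  ext v
  constructor
  · rintro ⟨P, hP, rfl⟩
    obtain ⟨g, hg, hgη, rfl⟩ := hP.exists_eq_chainLaw hn
    have hgr : Measurable fun p => (g p).toReal - 1 := hg.measurable.ennreal_toReal.sub_const 1
    have hmem : MemLp (fun p => (g p).toReal - 1) 2 (π.prod π) := by
      rw [memLp_two_iff_integrable_sq hgr.aestronglyMeasurable]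
      refine ⟨(hgr.pow_const 2).aestronglyMeasurable, ?_⟩
      rw [hasFiniteIntegral_iff_ofReal (ae_of_all _ fun p => sq_nonneg _)]
      exact hgη.trans_lt ENNReal.ofReal_lt_top
    set w := hmem.toLp with hw
    have hwg : ∀ᵐ p ∂(π.prod π), w p = (g p).toReal - 1 := hmem.coeFn_toLp
    refine ⟨w, ⟨(mem_densityDeviations_iff π).2 ⟨?_, ?_, ?_⟩, (hnorm w).2 ?_⟩, ?_⟩
    · filter_upwards [hwg] with p hp
      rw [hp]; simp
    · filter_upwards [hg.lintegral_fst, Measure.ae_ae_of_ae_prod hwg] with x hx hxw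
      have hmx : Measurable fun y => g (x, y) := hg.measurable.comp (by fun_prop)
      have hfin : ∀ᵐ y ∂π, g (x, y) < ∞ := ae_lt_top hmx (by simp [hx])
      rw [integral_congr_ae hxw, integral_sub
        (integrable_toReal_of_lintegral_ne_top hmx.aemeasurable (by simp [hx]))
        (integrable_const _), integral_toReal hmx.aemeasurable hfin, hx]
      simp
    · have hwg' : ∀ᵐ p ∂(π.prod π), w p.swap = (g p.swap).toReal - 1 :=
        (Measure.measurePreserving_swap (μ := π) (ν := π)).quasiMeasurePreserving.ae hwg
      filter_upwards [hg.lintegral_snd, Measure.ae_ae_of_ae_prod hwg'] with y hy hyw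
      simp only [Prod.swap_prod_mk] at hyw
      have hmx : Measurable fun x => g (x, y) := hg.measurable.comp (by fun_prop)
      have hfin : ∀ᵐ x ∂π, g (x, y) < ∞ := ae_lt_top hmx (by simp [hy])
      rw [integral_congr_ae hyw, integral_sub
        (integrable_toReal_of_lintegral_ne_top hmx.aemeasurable (by simp [hy]))
        (integrable_const _), integral_toReal hmx.aemeasurable hfin, hy]
      simp
    · refine le_trans (le_of_eq (lintegral_congr_ae ?_)) hgη
      filter_upwards [hwg] with p hp
      rw [hp]
    · rw [integral_chainLaw hg, objective]
      refine integral_congr_ae ?_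
      have h2 : ∀ᵐ x ∂(baseline π n), ∀ i : Fin n,
          w (x i.castSucc, x i.succ) = (g (x i.castSucc, x i.succ)).toReal - 1 :=
        ae_all_iff.2 fun i => (measurePreserving_pair π i).quasiMeasurePreserving.ae hwg
      filter_upwards [h2] with x hx
      simp only [hx, add_sub_cancel]
  · rintro ⟨w, ⟨hwK, hwn⟩, rfl⟩
    have hg := isCopulaDensity_of_mem hwK
    have h0 := ((mem_densityDeviations_iff π).1 hwK).1
    refine ⟨_, feasible_chainLaw (n := n) hg (η := η) ?_, ?_⟩
    · refine le_trans (le_of_eq (lintegral_congr_ae ?_)) ((hnorm w).1 hwn)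
      filter_upwards [h0] with p hp
      rw [ENNReal.toReal_ofReal hp, add_sub_cancel_left]
    · rw [integral_chainLaw hg, objective]
      refine integral_congr_ae ?_
      have h2 : ∀ᵐ x ∂(baseline π n), ∀ i : Fin n, 0 ≤ 1 + w (x i.castSucc, x i.succ) :=
        ae_all_iff.2 fun i => (measurePreserving_pair π i).quasiMeasurePreserving.ae h0
      filter_upwards [h2] with x hx
      simp only [ENNReal.toReal_ofReal (hx _)]

end Functional

/-! ### Second-order expansions with cubic remainder -/

/-- Second-order expansion of a product of factors close to one. -/
theorem exists_abs_prod_one_add_sub_le (n : ℕ) (M : ℝ) (hM : 0 ≤ M) :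
    ∃ C, 0 ≤ C ∧ ∀ a : Fin n → ℝ, (∀ i, |a i| ≤ M) → ∀ t : ℝ, 0 ≤ t → t ≤ 1 →
      |∏ i, (1 + t * a i) - (1 + t * ∑ i, a i + t ^ 2 * ∑ j, ∑ i with i < j, a i * a j)| ≤
        C * t ^ 3 := by
  induction n with
  | zero => exact ⟨0, le_rfl, fun a _ t _ _ => by simp⟩
  | succ n ih =>
    obtain ⟨C, hC, ih⟩ := ih
    -- Multiplying by a new factor 1 + tc inflates the old remainder by at most 1 + M and creates
    -- one new cubic term t³Qc, where |Q| ≤ n²M².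
    refine ⟨n * (n * (M * M)) * M + C * (1 + M), by positivity, fun a ha t ht0 ht1 => ?_⟩
    set b : Fin n → ℝ := fun i => a i.castSucc with hb
    set c := a (Fin.last n) with hc
    set S := ∑ i, b i with hS
    set Q := ∑ j, ∑ i with i < j, b i * b j with hQ
    have h1 := ih b (fun i => ha _) t ht0 ht1
    have hcM : |c| ≤ M := ha _
    have hQM : |Q| ≤ n * (n * (M * M)) := by
      calc |Q| ≤ ∑ j : Fin n, |∑ i with i < j, b i * b j| := Finset.abs_sum_le_sum_abs _ _
        _ ≤ ∑ _j : Fin n, (n : ℝ) * (M * M) := by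
          refine Finset.sum_le_sum fun j _ => ?_
          calc |∑ i with i < j, b i * b j| ≤ ∑ i with i < j, |b i * b j| :=
                Finset.abs_sum_le_sum_abs _ _
            _ ≤ ∑ i : Fin n, |b i * b j| :=
                Finset.sum_le_sum_of_subset_of_nonneg (Finset.filter_subset _ _)
                  fun _ _ _ => abs_nonneg _
            _ ≤ ∑ _i : Fin n, M * M := by
                refine Finset.sum_le_sum fun i _ => ?_
                rw [abs_mul]
                exact mul_le_mul (ha _) (ha _) (abs_nonneg _) hM
            _ = n * (M * M) := by simp
        _ = _ := by simp
    have e1 : ∑ i, a i = S + c := Fin.sum_univ_castSucc a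
    have e2 : ∑ j, ∑ i with i < j, a i * a j = Q + S * c := by
      simp only [Finset.sum_filter]
      rw [Fin.sum_univ_castSucc, Fin.sum_univ_castSucc]
      simp only [Fin.sum_univ_castSucc, Fin.castSucc_lt_castSucc_iff, Fin.castSucc_lt_last,
        if_true, lt_irrefl, if_false, add_zero, hQ, Finset.sum_filter, hS, Finset.sum_mul, hb, hc,
        (Fin.castSucc_lt_last _).not_gt]
    rw [Fin.prod_univ_castSucc, e1, e2]
    set p := ∏ i, (1 + t * b i) with hp
    have e3 : p * (1 + t * c) - (1 + t * (S + c) + t ^ 2 * (Q + S * c)) =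
        (p - (1 + t * S + t ^ 2 * Q)) * (1 + t * c) + t ^ 3 * (Q * c) := by ring
    have h2 : |1 + t * c| ≤ 1 + M := by
      calc |1 + t * c| ≤ |(1 : ℝ)| + |t * c| := abs_add_le _ _
        _ ≤ 1 + M := by
          rw [abs_one, abs_mul, abs_of_nonneg ht0]
          have := mul_le_of_le_one_left (abs_nonneg c) ht1
          linarith
    calc |p * (1 + t * c) - (1 + t * (S + c) + t ^ 2 * (Q + S * c))|
        ≤ |(p - (1 + t * S + t ^ 2 * Q)) * (1 + t * c)| + |t ^ 3 * (Q * c)| := by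
          rw [e3]; exact abs_add_le _ _
      _ ≤ C * t ^ 3 * (1 + M) + t ^ 3 * (n * (n * (M * M)) * M) := by
          rw [abs_mul, abs_mul, abs_mul, abs_of_nonneg (pow_nonneg ht0 3)]
          gcongr
      _ = _ := by ring

theorem integral_sub_sub_add {α : Type*} [MeasurableSpace α] {μ : Measure α} {f g k l : α → ℝ}
    (hf : Integrable f μ) (hg : Integrable g μ) (hk : Integrable k μ) (hl : Integrable l μ) :
    ∫ a, (f a - g a - k a + l a) ∂μ = ∫ a, f a ∂μ - ∫ a, g a ∂μ - ∫ a, k a ∂μ + ∫ a, l a ∂μ := by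
  rw [integral_add (f := fun a => f a - g a - k a) ((hf.sub hg).sub hk) hl,
    integral_sub (f := fun a => f a - g a) (hf.sub hg) hk, integral_sub hf hg]

/-- Second-order expansion of the integral of a product of factors close to one. -/
theorem exists_abs_integral_mul_prod_sub_le {α : Type*} [MeasurableSpace α] {μ : Measure α}
    [IsProbabilityMeasure μ] {n : ℕ} {h : α → ℝ} {C : ℝ} (h_meas : Measurable h)
    (hC : ∀ x, |h x| ≤ C) {a : Fin n → α → ℝ} (ham : ∀ i, Measurable (a i)) {M : ℝ} (hM : 0 ≤ M)
    (hab : ∀ i x, |a i x| ≤ M) :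
    ∃ D, ∀ t : ℝ, 0 ≤ t → t ≤ 1 → |∫ x, h x * ∏ i, (1 + t * a i x) ∂μ -
      (∫ x, h x ∂μ + t * ∑ i, ∫ x, h x * a i x ∂μ + t ^ 2 * (∑ j : Fin n, ∑ i with i < j,
        ∫ x, a i x * a j x * h x ∂μ))| ≤ D * t ^ 3 := by
  have hC0 : 0 ≤ C := by
    obtain ⟨x⟩ := nonempty_of_isProbabilityMeasure μ
    exact (abs_nonneg _).trans (hC x)
  obtain ⟨D, hD, hexp⟩ := exists_abs_prod_one_add_sub_le n M hM
  refine ⟨C * D, fun t ht0 ht1 => ?_⟩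
  have hai : ∀ i, Integrable (a i) μ := fun i =>
    Integrable.of_bound (ham i).aestronglyMeasurable _ (ae_of_all _ (hab i))
  have hhi : Integrable h μ :=
    Integrable.of_bound h_meas.aestronglyMeasurable C (ae_of_all _ hC)
  have hha : ∀ i, Integrable (fun x => h x * a i x) μ := fun i =>
    integrable_mul_of_bound h_meas hC (hai i)
  have haah : ∀ i j, Integrable (fun x => a i x * a j x * h x) μ := fun i j => by
    have := integrable_mul_of_bound (ham i) (hab i) (integrable_mul_of_bound (ham j) (hab j) hhi)
    simpa only [mul_assoc] using this
  have hS : Integrable (fun x => ∑ i, h x * a i x) μ := integrable_finsetSum _ fun i _ => hha i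
  have hQ : Integrable (fun x => ∑ j, ∑ i with i < j, a i x * a j x * h x) μ :=
    integrable_finsetSum _ fun j _ => integrable_finsetSum _ fun i _ => haah i j
  have hhq : ∀ x, h x * (1 + t * ∑ i, a i x + t ^ 2 * ∑ j, ∑ i with i < j, a i x * a j x) =
      h x + t * ∑ i, h x * a i x + t ^ 2 * ∑ j, ∑ i with i < j, a i x * a j x * h x := fun x => by
    have s1 : ∑ i, h x * a i x = h x * ∑ i, a i x := (Finset.mul_sum _ _ _).symm
    have s2 : ∑ j, ∑ i with i < j, a i x * a j x * h x =
        (∑ j, ∑ i with i < j, a i x * a j x) * h x := by simp only [Finset.sum_mul]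
    rw [s1, s2]
    ring
  have hi1 : Integrable (fun x => h x + t * ∑ i, h x * a i x) μ := hhi.add (hS.const_mul t)
  have hi2 : Integrable (fun x => h x + t * ∑ i, h x * a i x +
      t ^ 2 * ∑ j, ∑ i with i < j, a i x * a j x * h x) μ := hi1.add (hQ.const_mul _)
  have e2 : ∫ x, h x ∂μ + t * ∑ i, ∫ x, h x * a i x ∂μ + t ^ 2 * (∑ j : Fin n, ∑ i with i < j,
      ∫ x, a i x * a j x * h x ∂μ) = ∫ x, (h x + t * ∑ i, h x * a i x +
      t ^ 2 * ∑ j, ∑ i with i < j, a i x * a j x * h x) ∂μ := by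
    rw [integral_add hi1 (hQ.const_mul _),
      integral_add hhi (hS.const_mul t), integral_const_mul, integral_const_mul,
      integral_finsetSum _ fun i _ => hha i,
      integral_finsetSum _ fun j _ => integrable_finsetSum _ fun i _ => haah i j]
    congr 2
    exact Finset.sum_congr rfl fun j _ => (integral_finsetSum _ fun i _ => haah i j).symm
  have hpi : Integrable (fun x => h x * ∏ i, (1 + t * a i x)) μ := by
    have hm : Measurable fun x => ∏ i, (1 + t * a i x) :=
      Finset.measurable_fun_prod _ fun i _ => ((ham i).const_mul t).const_add 1
    refine integrable_mul_of_bound h_meas hC (Integrable.of_bound hm.aestronglyMeasurable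
      (∏ _i : Fin n, (1 + M)) (ae_of_all _ fun x => ?_))
    rw [norm_prod]
    refine Finset.prod_le_prod (fun i _ => norm_nonneg _) fun i _ => ?_
    refine (norm_add_le _ _).trans ?_
    rw [norm_one, norm_mul, Real.norm_eq_abs, Real.norm_eq_abs, abs_of_nonneg ht0]
    have := mul_le_of_le_one_left (abs_nonneg (a i x)) ht1
    linarith [hab i x]
  rw [e2, ← integral_sub hpi hi2]
  have hb : ∀ x, ‖h x * ∏ i, (1 + t * a i x) - (h x + t * ∑ i, h x * a i x +
      t ^ 2 * ∑ j, ∑ i with i < j, a i x * a j x * h x)‖ ≤ C * D * t ^ 3 := fun x => by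
    rw [← hhq, ← mul_sub, norm_mul, mul_assoc]
    exact mul_le_mul (hC x) (hexp (fun i => a i x) (fun i => hab i x) t ht0 ht1) (norm_nonneg _) hC0
  have := norm_integral_le_of_norm_le_const (μ := μ) (ae_of_all _ hb)
  rwa [probReal_univ, mul_one] at this

/-! ### The interaction part as the gradient at the i.i.d. law -/

section Coefficients

variable {n : ℕ} (π : Measure 𝒳) [IsProbabilityMeasure π] {h : (Fin (n + 1) → 𝒳) → ℝ} {C : ℝ}

theorem measurable_condMean (h_meas : Measurable h) (i : Fin n) :
    Measurable fun p : 𝒳 × 𝒳 => condMean π h i p.1 p.2 := by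
  have hne : i.castSucc ≠ i.succ := Fin.castSucc_lt_succ.ne
  have hm : Measurable fun q : (𝒳 × 𝒳) × (Fin (n + 1) → 𝒳) =>
      Function.update (Function.update q.2 i.castSucc q.1.1) i.succ q.1.2 := by
    refine measurable_pi_lambda _ fun j => ?_
    by_cases h1 : j = i.succ
    · subst h1; simp; fun_prop
    · by_cases h2 : j = i.castSucc
      · subst h2; simp [hne]; fun_prop
      · simp [h1, h2]; fun_prop
  exact (StronglyMeasurable.integral_prod_right' (h_meas.comp hm).stronglyMeasurable).measurable

theorem abs_condMean_le (hC : ∀ x, |h x| ≤ C) (i : Fin n) (x y : 𝒳) :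
    |condMean π h i x y| ≤ C := by
  have := norm_integral_le_of_norm_le_const (μ := baseline π n) (C := C)
    (f := fun z => h (Function.update (Function.update z i.castSucc x) i.succ y))
    (ae_of_all _ fun z => hC _)
  simpa [condMean] using this

theorem measurable_H (h_meas : Measurable h) : Measurable fun p : 𝒳 × 𝒳 => H π h p.1 p.2 :=
  Finset.measurable_fun_sum _ fun i _ => measurable_condMean π h_meas i

theorem abs_H_le (hC : ∀ x, |h x| ≤ C) (x y : 𝒳) : |H π h x y| ≤ n * C := by
  calc |H π h x y| ≤ ∑ i : Fin n, |condMean π h i x y| := Finset.abs_sum_le_sum_abs _ _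
    _ ≤ ∑ _i : Fin n, C := Finset.sum_le_sum fun i _ => abs_condMean_le π hC i x y
    _ = n * C := by simp

theorem integrable_H (h_meas : Measurable h) (hC : ∀ x, |h x| ≤ C) :
    Integrable (fun p : 𝒳 × 𝒳 => H π h p.1 p.2) (π.prod π) :=
  Integrable.of_bound (measurable_H π h_meas).aestronglyMeasurable (n * C)
    (ae_of_all _ fun p => abs_H_le π hC p.1 p.2)

theorem measurable_R (h_meas : Measurable h) : Measurable fun p : 𝒳 × 𝒳 => R π h p.1 p.2 := by
  have h1 : Measurable fun x => ∫ y', H π h x y' ∂π :=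
    (StronglyMeasurable.integral_prod_right' (measurable_H π h_meas).stronglyMeasurable).measurable
  have h2 : Measurable fun y => ∫ x', H π h x' y ∂π :=
    (StronglyMeasurable.integral_prod_left' (measurable_H π h_meas).stronglyMeasurable).measurable
  exact (((measurable_H π h_meas).sub (h1.comp measurable_fst)).sub
    (h2.comp measurable_snd)).add_const _

theorem abs_R_le (hC : ∀ x, |h x| ≤ C) (x y : 𝒳) : |R π h x y| ≤ 4 * (n * C) := by
  have h0 := abs_H_le π hC x y
  have h1 : |∫ y', H π h x y' ∂π| ≤ n * C := by
    simpa using norm_integral_le_of_norm_le_const (μ := π) (f := fun y' => H π h x y')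
      (ae_of_all _ fun y' => abs_H_le π hC x y')
  have h2 : |∫ x', H π h x' y ∂π| ≤ n * C := by
    simpa using norm_integral_le_of_norm_le_const (μ := π) (f := fun x' => H π h x' y)
      (ae_of_all _ fun x' => abs_H_le π hC x' y)
  have h3 : |∫ p : 𝒳 × 𝒳, H π h p.1 p.2 ∂(π.prod π)| ≤ n * C := by
    simpa using norm_integral_le_of_norm_le_const (μ := π.prod π)
      (f := fun p : 𝒳 × 𝒳 => H π h p.1 p.2) (ae_of_all _ fun p => abs_H_le π hC p.1 p.2)
  rw [abs_le] at *
  unfold R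
  constructor <;> linarith [h0.1, h0.2, h1.1, h1.2, h2.1, h2.2, h3.1, h3.2]

/-- Double centring: the mean of H in y cancels against its own copy, and the mean of the other
one-variable term cancels against the overall mean. -/
theorem integral_R_right (h_meas : Measurable h) (hC : ∀ x, |h x| ≤ C) (x : 𝒳) :
    ∫ y, R π h x y ∂π = 0 := by
  have hint := integrable_H π h_meas hC
  have h1 : Integrable (fun y => H π h x y) π :=
    Integrable.of_bound ((measurable_H π h_meas).comp
      (measurable_const.prodMk measurable_id)).aestronglyMeasurable (n * C)
      (ae_of_all _ fun y => abs_H_le π hC x y)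
  have h2 : Integrable (fun y => ∫ x', H π h x' y ∂π) π := hint.integral_prod_right
  unfold R
  rw [integral_sub_sub_add h1 (integrable_const _) h2 (integrable_const _),
    integral_prod_symm _ hint]
  simp

theorem integral_R_left (h_meas : Measurable h) (hC : ∀ x, |h x| ≤ C) (y : 𝒳) :
    ∫ x, R π h x y ∂π = 0 := by
  have hint := integrable_H π h_meas hC
  have h1 : Integrable (fun x => H π h x y) π :=
    Integrable.of_bound ((measurable_H π h_meas).comp
      (measurable_id.prodMk measurable_const)).aestronglyMeasurable (n * C)
      (ae_of_all _ fun x => abs_H_le π hC x y)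
  have h2 : Integrable (fun x => ∫ y', H π h x y' ∂π) π := hint.integral_prod_left
  unfold R
  rw [integral_sub_sub_add h1 h2 (integrable_const _) (integrable_const _),
    integral_prod _ hint]
  simp

theorem memLp_R (h_meas : Measurable h) (hC : ∀ x, |h x| ≤ C) :
    MemLp (fun p : 𝒳 × 𝒳 => R π h p.1 p.2) 2 (π.prod π) :=
  MemLp.of_bound (measurable_R π h_meas).aestronglyMeasurable (4 * (n * C))
    (ae_of_all _ fun p => abs_R_le π hC p.1 p.2)

theorem varR_eq_integral_sq (h_meas : Measurable h) (hC : ∀ x, |h x| ≤ C) :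
    varR π h = ∫ p : 𝒳 × 𝒳, R π h p.1 p.2 ^ 2 ∂(π.prod π) := by
  have hmean : ∫ p : 𝒳 × 𝒳, R π h p.1 p.2 ∂(π.prod π) = 0 := by
    rw [integral_prod _ ((memLp_R π h_meas hC).integrable (by norm_num))]
    simp [integral_R_right π h_meas hC]
  rw [varR, variance_of_integral_eq_zero (measurable_R π h_meas).aemeasurable hmean]

/-- `R` as an element of `L²(π × π)`. -/
def RLp (h_meas : Measurable h) (hC : ∀ x, |h x| ≤ C) : Lp ℝ 2 (π.prod π) :=
  (memLp_R π h_meas hC).toLp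

theorem coeFn_RLp (h_meas : Measurable h) (hC : ∀ x, |h x| ≤ C) :
    RLp π h_meas hC =ᵐ[π.prod π] fun p => R π h p.1 p.2 := (memLp_R π h_meas hC).coeFn_toLp

theorem coeFn_smul_RLp (h_meas : Measurable h) (hC : ∀ x, |h x| ≤ C) (t : ℝ) :
    ∀ᵐ p ∂(π.prod π), (t • RLp π h_meas hC) p = t * R π h p.1 p.2 := by
  filter_upwards [Lp.coeFn_smul t (RLp π h_meas hC), coeFn_RLp π h_meas hC] with p h1 h2
  rw [h1, Pi.smul_apply, h2, smul_eq_mul]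

theorem norm_RLp_sq (h_meas : Measurable h) (hC : ∀ x, |h x| ≤ C) :
    ‖RLp π h_meas hC‖ ^ 2 = varR π h := by
  rw [varR_eq_integral_sq π h_meas hC, ← real_inner_self_eq_norm_sq, L2.inner_def]
  refine integral_congr_ae ?_
  filter_upwards [coeFn_RLp π h_meas hC] with p hp
  rw [real_inner_self_eq_norm_sq, hp, Real.norm_eq_abs, sq_abs]

/-- R has vanishing marginals and is bounded by 4nC, so 1 + tR is a density for small t. Thus the
direction of steepest ascent is admissible. -/
theorem smul_RLp_mem (h_meas : Measurable h) (hC : ∀ x, |h x| ≤ C) {t : ℝ}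
    (ht0 : 0 ≤ t) (ht : t * (4 * (n * C)) ≤ 1) :
    t • RLp π h_meas hC ∈ densityDeviations π := by
  have h1 := coeFn_smul_RLp π h_meas hC t
  rw [mem_densityDeviations_iff]
  refine ⟨?_, ?_, ?_⟩
  · filter_upwards [h1] with p hp
    rw [hp]
    have h2 := (abs_le.1 (abs_R_le π hC p.1 p.2)).1
    nlinarith
  · filter_upwards [Measure.ae_ae_of_ae_prod h1] with x hx
    rw [integral_congr_ae hx]
    simp [integral_const_mul, integral_R_right π h_meas hC]
  · have h1' : ∀ᵐ p ∂(π.prod π), (t • RLp π h_meas hC) p.swap = t * R π h p.swap.1 p.swap.2 :=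
      (Measure.measurePreserving_swap (μ := π) (ν := π)).quasiMeasurePreserving.ae h1
    filter_upwards [Measure.ae_ae_of_ae_prod h1'] with y hy
    simp only [Prod.swap_prod_mk] at hy
    rw [integral_congr_ae hy]
    simp [integral_const_mul, integral_R_left π h_meas hC]

/-- Conditioning on the pair of states lets w be pulled out, leaving the conditional mean of h. -/
theorem integral_mul_pair_eq (h_meas : Measurable h) (hC : ∀ x, |h x| ≤ C) (i : Fin n)
    (w : Lp ℝ 2 (π.prod π)) :
    ∫ x, h x * w (x i.castSucc, x i.succ) ∂(baseline π n) =
      ∫ p : 𝒳 × 𝒳, condMean π h i p.1 p.2 * w p ∂(π.prod π) := by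
  have hpair := measurePreserving_pair π i
  have hwm := measurable_coe_Lp w
  have hwi : Integrable (fun x : Fin (n + 1) → 𝒳 => w (x i.castSucc, x i.succ)) (baseline π n) :=
    (hpair.integrable_comp hwm.aestronglyMeasurable).2 (integrable_coe_Lp π w)
  have hhi : Integrable h (baseline π n) :=
    Integrable.of_bound h_meas.aestronglyMeasurable C (ae_of_all _ hC)
  have hwsm : StronglyMeasurable[MeasurableSpace.comap
      (fun x : Fin (n + 1) → 𝒳 => (x i.castSucc, x i.succ)) inferInstance]
      fun x : Fin (n + 1) → 𝒳 => w (x i.castSucc, x i.succ) :=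
    (hwm.comp (comap_measurable _)).stronglyMeasurable
  have h1 := condExp_mul_of_stronglyMeasurable_right (μ := baseline π n) hwsm
    (integrable_mul_of_bound h_meas hC hwi) hhi
  have h2 := condExp_ae_eq_condMean π h h_meas ⟨C, hC⟩ i
  have h3 : Measurable fun p : 𝒳 × 𝒳 => condMean π h i p.1 p.2 * w p :=
    (measurable_condMean π h_meas i).mul hwm
  have h4 := integral_map (μ := baseline π n) hpair.measurable.aemeasurable
    h3.aestronglyMeasurable
  rw [hpair.map_eq] at h4
  rw [h4, ← integral_condExp hpair.measurable.comap_le]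
  refine integral_congr_ae ?_
  filter_upwards [h1, h2] with x h1 h2
  rw [Pi.mul_apply, h2] at h1
  exact h1

/-- The derivative is E₀[H w]. The terms by which R differs from H depend on at most one of the two
variables, hence are orthogonal to w, whose marginals vanish. -/
theorem fderiv_objective_zero_eq_inner (h_meas : Measurable h) (hC : ∀ x, |h x| ≤ C)
    {w : Lp ℝ 2 (π.prod π)} (hw : w ∈ densityDeviations π) :
    fderiv ℝ (objective π h) 0 w = inner ℝ (RLp π h_meas hC) w := by
  obtain ⟨-, hw1, hw2⟩ := (mem_densityDeviations_iff π).1 hw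
  have hwi := integrable_coe_Lp π w
  have hHm := measurable_H π h_meas
  have hH1m : Measurable fun p : 𝒳 × 𝒳 => ∫ y', H π h p.1 y' ∂π :=
    (StronglyMeasurable.integral_prod_right' hHm.stronglyMeasurable).measurable.comp measurable_fst
  have hH2m : Measurable fun p : 𝒳 × 𝒳 => ∫ x', H π h x' p.2 ∂π :=
    (StronglyMeasurable.integral_prod_left' hHm.stronglyMeasurable).measurable.comp measurable_snd
  have hH1b : ∀ p : 𝒳 × 𝒳, |∫ y', H π h p.1 y' ∂π| ≤ n * C := fun p => by
    simpa using norm_integral_le_of_norm_le_const (μ := π) (f := fun y' => H π h p.1 y')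
      (ae_of_all _ fun y' => abs_H_le π hC p.1 y')
  have hH2b : ∀ p : 𝒳 × 𝒳, |∫ x', H π h x' p.2 ∂π| ≤ n * C := fun p => by
    simpa using norm_integral_le_of_norm_le_const (μ := π) (f := fun x' => H π h x' p.2)
      (ae_of_all _ fun x' => abs_H_le π hC x' p.2)
  have i0 := integrable_mul_of_bound hHm (fun p : 𝒳 × 𝒳 => abs_H_le π hC p.1 p.2) hwi
  have i1 := integrable_mul_of_bound hH1m hH1b hwi
  have i2 := integrable_mul_of_bound hH2m hH2b hwi
  have i3 : Integrable (fun p => (∫ p : 𝒳 × 𝒳, H π h p.1 p.2 ∂(π.prod π)) * w p) (π.prod π) :=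
    hwi.const_mul _
  have z1 : ∫ p : 𝒳 × 𝒳, (∫ y', H π h p.1 y' ∂π) * w p ∂(π.prod π) = 0 := by
    rw [integral_prod _ i1]
    refine integral_eq_zero_of_ae ?_
    filter_upwards [hw1] with x hx
    simp [integral_const_mul, hx]
  have z2 : ∫ p : 𝒳 × 𝒳, (∫ x', H π h x' p.2 ∂π) * w p ∂(π.prod π) = 0 := by
    rw [integral_prod_symm _ i2]
    refine integral_eq_zero_of_ae ?_
    filter_upwards [hw2] with x hx
    simp [integral_const_mul, hx]
  have z3 : ∫ p : 𝒳 × 𝒳, (∫ p : 𝒳 × 𝒳, H π h p.1 p.2 ∂(π.prod π)) * w p ∂(π.prod π) = 0 := by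
    rw [integral_const_mul, integral_prod _ hwi, integral_eq_zero_of_ae hw1, mul_zero]
  have e1 : inner ℝ (RLp π h_meas hC) w = ∫ p : 𝒳 × 𝒳, (H π h p.1 p.2 * w p -
      (∫ y', H π h p.1 y' ∂π) * w p - (∫ x', H π h x' p.2 ∂π) * w p +
      (∫ p : 𝒳 × 𝒳, H π h p.1 p.2 ∂(π.prod π)) * w p) ∂(π.prod π) := by
    rw [L2.inner_def]
    refine integral_congr_ae ?_
    filter_upwards [coeFn_RLp π h_meas hC] with p hp
    rw [hp, RCLike.inner_apply, conj_trivial, R]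
    ring
  rw [e1, integral_sub_sub_add i0 i1 i2 i3, z1, z2, z3, fderiv_objective_zero π h_meas hC]
  simp only [integral_mul_pair_eq π h_meas hC]
  rw [← integral_finsetSum]
  · simp only [← Finset.sum_mul, sub_zero, add_zero]; rfl
  · exact fun i _ => integrable_mul_of_bound (measurable_condMean π h_meas i)
      (fun p => abs_condMean_le π hC i p.1 p.2) hwi

/-- The derivative of the objective in the direction R, computed in two ways. Its inner product form
is available only on `densityDeviations`, so it is evaluated at a small multiple sR and divided by
s; the added 1 in the denominator of s covers C = 0. -/
theorem varR_eq_sum_integral (h_meas : Measurable h) (hC : ∀ x, |h x| ≤ C) :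
    varR π h = ∑ i : Fin n, ∫ x, h x * R π h (x i.castSucc) (x i.succ) ∂(baseline π n) := by
  have hC0 : 0 ≤ C := by
    obtain ⟨x⟩ := nonempty_of_isProbabilityMeasure (baseline π n)
    exact (abs_nonneg _).trans (hC x)
  set s : ℝ := 1 / (4 * (n * C) + 1) with hs
  have hs0 : 0 < s := by positivity
  have h1 : s • RLp π h_meas hC ∈ densityDeviations π := by
    refine smul_RLp_mem π h_meas hC hs0.le ?_
    rw [hs, one_div, inv_mul_le_iff₀ (by positivity)]
    linarith
  have h2 := fderiv_objective_zero_eq_inner π h_meas hC h1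
  rw [map_smul, inner_smul_right, real_inner_self_eq_norm_sq, norm_RLp_sq, smul_eq_mul] at h2
  rw [← mul_left_cancel₀ hs0.ne' h2, fderiv_objective_zero π h_meas hC]
  refine Finset.sum_congr rfl fun i _ => integral_congr_ae ?_
  filter_upwards [(measurePreserving_pair π i).quasiMeasurePreserving.ae
    (coeFn_RLp π h_meas hC)] with x hx
  rw [hx]

/-- Expansion of the objective in the direction of `R`. -/
theorem exists_abs_objective_smul_RLp_sub_le (h_meas : Measurable h) (hC : ∀ x, |h x| ≤ C) :
    ∃ D, ∀ t : ℝ, 0 ≤ t → t ≤ 1 → |objective π h (t • RLp π h_meas hC) -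
      (∫ x, h x ∂(baseline π n) + t * varR π h + t ^ 2 * (∑ j : Fin n, ∑ i with i < j,
        ∫ x, R π h (x i.castSucc) (x i.succ) * R π h (x j.castSucc) (x j.succ) * h x
          ∂(baseline π n)))| ≤ D * t ^ 3 := by
  have hC0 : 0 ≤ C := by
    obtain ⟨x⟩ := nonempty_of_isProbabilityMeasure (baseline π n)
    exact (abs_nonneg _).trans (hC x)
  have hM : 0 ≤ 4 * (n * C) := by positivity
  have ham : ∀ i : Fin n, Measurable fun x : Fin (n + 1) → 𝒳 =>
      R π h (x i.castSucc) (x i.succ) := fun i =>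
    Measurable.comp (g := fun p : 𝒳 × 𝒳 => R π h p.1 p.2)
      (f := fun x : Fin (n + 1) → 𝒳 => (x i.castSucc, x i.succ)) (measurable_R π h_meas)
      (measurePreserving_pair π i).measurable
  obtain ⟨D, hexp⟩ := exists_abs_integral_mul_prod_sub_le (μ := baseline π n) h_meas hC ham hM
    (fun i x => abs_R_le π hC (x i.castSucc) (x i.succ))
  refine ⟨D, fun t ht0 ht1 => ?_⟩
  have e0 : objective π h (t • RLp π h_meas hC) =
      ∫ x, h x * ∏ i : Fin n, (1 + t * R π h (x i.castSucc) (x i.succ)) ∂(baseline π n) := by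
    rw [objective]
    refine integral_congr_ae ?_
    have h2 : ∀ᵐ x ∂(baseline π n), ∀ i : Fin n,
        (t • RLp π h_meas hC) (x i.castSucc, x i.succ) = t * R π h (x i.castSucc) (x i.succ) :=
      ae_all_iff.2 fun i => (measurePreserving_pair π i).quasiMeasurePreserving.ae
        (coeFn_smul_RLp π h_meas hC t)
    filter_upwards [h2] with x hx
    simp only [hx]
  rw [e0, varR_eq_sum_integral π h_meas hC]
  exact hexp t ht0 ht1

end Coefficients

/-! ### Expansion of the optimal values -/

section Expansion

variable {n : ℕ} (π : Measure 𝒳) [IsProbabilityMeasure π] {h : (Fin (n + 1) → 𝒳) → ℝ}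

/-- With a single state there are no transitions, so H is an empty sum and R vanishes. -/
theorem pos_of_varR_pos (h_var : 0 < varR π h) : 0 < n := by
  rcases Nat.eq_zero_or_pos n with rfl | hn
  · exfalso
    have : (fun p : 𝒳 × 𝒳 => R π h p.1 p.2) = 0 := by
      funext p; simp [R, H]
    rw [varR, this, variance_zero] at h_var
    exact lt_irrefl _ h_var
  · exact hn

theorem tendsto_sqrt_nhdsGT_zero : Tendsto (fun η : ℝ => √η) (𝓝[>] 0) (𝓝[>] 0) := by
  refine tendsto_nhdsWithin_iff.2 ⟨?_, ?_⟩
  · have : Tendsto (fun η : ℝ => √η) (𝓝 0) (𝓝 √0) := Real.continuous_sqrt.tendsto 0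
    rw [Real.sqrt_zero] at this
    exact this.mono_left nhdsWithin_le_nhds
  · filter_upwards [self_mem_nhdsWithin] with η hη
    exact Real.sqrt_pos.2 hη

/-- Attainment and expansion of the maximal value. -/
theorem maxValue_expansion (h_meas : Measurable h) (h_bdd : ∃ C : ℝ, ∀ x, |h x| ≤ C)
    (h_var : 0 < varR π h) :
    (∀ᶠ η in 𝓝[>] (0 : ℝ), IsGreatest (objectiveValues π h η) (maxValue π h η)) ∧
      (fun η : ℝ => maxValue π h η -
          (∫ x, h x ∂(baseline π n) + Xi₁ π h * √η + Xi₂ π h * η))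
        =O[𝓝[>] (0 : ℝ)] fun η : ℝ => η ^ (3 / 2 : ℝ) := by
  obtain ⟨C, hC⟩ := h_bdd
  have hC0 : 0 ≤ C := by
    obtain ⟨x⟩ := nonempty_of_isProbabilityMeasure (baseline π n)
    exact (abs_nonneg _).trans (hC x)
  have hn := pos_of_varR_pos π h_var
  set r := RLp π h_meas hC with hr
  have hr2 : ‖r‖ ^ 2 = varR π h := norm_RLp_sq π h_meas hC
  have hr0 : 0 < ‖r‖ := by
    refine (norm_nonneg r).lt_of_ne fun h0 => ?_
    rw [← hr2, ← h0] at h_var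
    norm_num at h_var
  have hM : 0 ≤ 4 * (n * C) := mul_nonneg (by norm_num) (mul_nonneg n.cast_nonneg hC0)
  obtain ⟨C', hmax⟩ := exists_isMaxOn_inter_closedBall (contDiff_objective π h_meas hC)
    (convex_densityDeviations π) (isClosed_densityDeviations π) (norm_pos_iff.1 hr0)
    (fun w hw => fderiv_objective_zero_eq_inner π h_meas hC hw)
    (t₀ := 1 / (4 * (n * C) + 1)) (by positivity) (fun t ht0 ht => by
      refine smul_RLp_mem π h_meas hC ht0 ?_
      calc t * (4 * (n * C)) ≤ 1 / (4 * (n * C) + 1) * (4 * (n * C)) := by gcongr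
        _ ≤ 1 := by
          rw [one_div, inv_mul_le_iff₀ (by linarith)]
          linarith)
  obtain ⟨D, hD⟩ := exists_abs_objective_smul_RLp_sub_le π h_meas hC
  -- The Hilbert space result is used with ρ = √η. The expansion along R is valid for t ≤ 1 and is
  -- applied at t = √η/‖r‖, hence the extra condition √η < ‖r‖.
  have hρ := tendsto_sqrt_nhdsGT_zero.eventually
    (hmax.and (Filter.Eventually.filter_mono nhdsWithin_le_nhds (eventually_lt_nhds hr0)))
  have hgreatest : ∀ᶠ η in 𝓝[>] (0 : ℝ), IsGreatest (objectiveValues π h η) (maxValue π h η) ∧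
      ‖maxValue π h η - (∫ x, h x ∂(baseline π n) + Xi₁ π h * √η + Xi₂ π h * η)‖ ≤
        (C' + D / ‖r‖ ^ 3) * ‖η ^ (3 / 2 : ℝ)‖ := by
    filter_upwards [hρ, self_mem_nhdsWithin] with η hη hη0
    have hη0 : 0 < η := hη0
    obtain ⟨⟨hzK, w, hwK, hwn, hwmax, hwz⟩, hρr⟩ := hη
    set ρ := √η with hρdef
    have hρ0 : 0 < ρ := Real.sqrt_pos.2 hη0
    have hρ2 : ρ ^ 2 = η := Real.sq_sqrt hη0.le
    set z := (ρ / ‖r‖) • r with hz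
    have hzn : ‖z‖ ≤ ρ := by
      rw [hz, norm_smul, Real.norm_eq_abs, abs_of_pos (by positivity)]
      exact le_of_eq (by field_simp)
    have hg : IsGreatest (objectiveValues π h η) (objective π h w) := by
      rw [objectiveValues_eq_image h hn hη0.le]
      refine ⟨⟨w, ⟨hwK, hwn⟩, rfl⟩, ?_⟩
      rintro _ ⟨v, ⟨hvK, hvn⟩, rfl⟩
      exact hwmax v hvK hvn
    have hmv : maxValue π h η = objective π h w := hg.csSup_eq
    refine ⟨hmv ▸ hg, ?_⟩
    have e1 := hD (ρ / ‖r‖) (by positivity) ((div_le_one hr0).2 hρr.le)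
    have e2 : Xi₁ π h = ‖r‖ := by rw [Xi₁, ← hr2, Real.sqrt_sq hr0.le]
    have e3 : ρ / ‖r‖ * varR π h = Xi₁ π h * ρ := by rw [e2, ← hr2]; field_simp
    have e4 : (ρ / ‖r‖) ^ 2 * (∑ j : Fin n, ∑ i with i < j,
        ∫ x, R π h (x i.castSucc) (x i.succ) * R π h (x j.castSucc) (x j.succ) * h x
          ∂(baseline π n)) = Xi₂ π h * η := by
      rw [Xi₂, ← hr2, ← hρ2, div_pow]; ring
    have e5 : η ^ (3 / 2 : ℝ) = ρ ^ 3 := by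
      rw [hρdef, Real.sqrt_eq_rpow, ← Real.rpow_natCast, ← Real.rpow_mul hη0.le]
      norm_num
    rw [e3, e4, ← hr, ← hz, div_pow] at e1
    have h1 := hwmax z hzK hzn
    have h3 : D * (ρ ^ 3 / ‖r‖ ^ 3) = D / ‖r‖ ^ 3 * ρ ^ 3 := by ring
    rw [hmv, e5, Real.norm_eq_abs, Real.norm_eq_abs, abs_of_pos (pow_pos hρ0 3), abs_le]
    rw [h3, abs_le] at e1
    -- The sign of `C'` is not prescribed, but `z` is itself a competitor: F z ≤ F w ≤ F z + C'ρ³.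
    have h4 : 0 ≤ C' * ρ ^ 3 := by linarith
    constructor <;> linarith [e1.1, e1.2]
  exact ⟨hgreatest.mono fun η hη => hη.1, IsBigO.of_bound _ (hgreatest.mono fun η hη => hη.2)⟩

theorem condMean_neg (i : Fin n) (x y : 𝒳) :
    condMean π (fun x => -h x) i x y = -condMean π h i x y := by
  simp only [condMean, integral_neg]

theorem R_neg (x y : 𝒳) : R π (fun x => -h x) x y = -R π h x y := by
  have hH : ∀ x y, H π (fun x => -h x) x y = -H π h x y := fun x y => by
    simp only [H, condMean_neg, Finset.sum_neg_distrib]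
  simp only [R, hH, integral_neg]
  ring

theorem varR_neg : varR π (fun x => -h x) = varR π h := by
  simp only [varR, R_neg]
  exact variance_neg

theorem Xi₁_neg : Xi₁ π (fun x => -h x) = Xi₁ π h := by rw [Xi₁, varR_neg, Xi₁]

/-- The numerator is cubic in h and the denominator quadratic, so Ξ₂ is odd in h whereas Ξ₁ is even.
Under min h = -max(-h) the √η term therefore changes sign and the η term does not. -/
theorem Xi₂_neg : Xi₂ π (fun x => -h x) = -Xi₂ π h := by
  simp only [Xi₂, varR_neg, R_neg, mul_neg, neg_mul, neg_neg, integral_neg, Finset.sum_neg_distrib,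
    neg_div]

theorem objectiveValues_neg (η : ℝ) :
    objectiveValues π (fun x => -h x) η = -objectiveValues π h η := by
  ext v
  simp only [objectiveValues, integral_neg, Set.mem_neg, Set.mem_ofPred_eq]
  exact exists_congr fun P => and_congr_right fun _ =>
    ⟨fun hv => by rw [hv, neg_neg], fun hv => by rw [← hv, neg_neg]⟩

/-- The infimum on ℝ is defined by reflecting the supremum, so the identity needs neither
boundedness nor nonemptiness. -/
theorem minValue_eq_neg_maxValue_neg (η : ℝ) :
    minValue π h η = -maxValue π (fun x => -h x) η := by
  rw [minValue, maxValue, objectiveValues_neg, Real.sInf_def]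

/-- Attainment and expansion of the minimal value. -/
theorem minValue_expansion (h_meas : Measurable h) (h_bdd : ∃ C : ℝ, ∀ x, |h x| ≤ C)
    (h_var : 0 < varR π h) :
    (∀ᶠ η in 𝓝[>] (0 : ℝ), IsLeast (objectiveValues π h η) (minValue π h η)) ∧
      (fun η : ℝ => minValue π h η -
          (∫ x, h x ∂(baseline π n) - Xi₁ π h * √η + Xi₂ π h * η))
        =O[𝓝[>] (0 : ℝ)] fun η : ℝ => η ^ (3 / 2 : ℝ) := by
  obtain ⟨h1, h2⟩ := maxValue_expansion π (h := fun x => -h x) h_meas.neg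
    (by simpa only [abs_neg] using h_bdd) (by rwa [varR_neg])
  refine ⟨h1.mono fun η hη => ?_, ?_⟩
  · rw [minValue_eq_neg_maxValue_neg]
    rw [objectiveValues_neg] at hη
    exact ⟨by simpa using hη.1, fun v hv => by
      have := hη.2 (show -v ∈ -objectiveValues π h η by simpa using hv)
      linarith⟩
  · refine h2.neg_left.congr_left fun η => ?_
    rw [minValue_eq_neg_maxValue_neg, Xi₁_neg, Xi₂_neg, integral_neg]
    ring

end Expansion

end SerialDependency

end

theorem theorem1 {𝒳 : Type*} [MeasurableSpace 𝒳] (π : Measure 𝒳) [IsProbabilityMeasure π]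
    (n : ℕ) (h : (Fin (n + 1) → 𝒳) → ℝ) (h_meas : Measurable h)
    (h_bdd : ∃ C : ℝ, ∀ x, |h x| ≤ C) (h_var : 0 < SerialDependency.varR π h) :
    ((∀ᶠ η in 𝓝[>] (0 : ℝ),
        IsGreatest (SerialDependency.objectiveValues π h η) (SerialDependency.maxValue π h η)) ∧
      (fun η : ℝ => SerialDependency.maxValue π h η -
          (∫ x, h x ∂(SerialDependency.baseline π n) + SerialDependency.Xi₁ π h * √η +
            SerialDependency.Xi₂ π h * η))
        =O[𝓝[>] (0 : ℝ)] fun η : ℝ => η ^ (3 / 2 : ℝ)) ∧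
    ((∀ᶠ η in 𝓝[>] (0 : ℝ),
        IsLeast (SerialDependency.objectiveValues π h η) (SerialDependency.minValue π h η)) ∧
      (fun η : ℝ => SerialDependency.minValue π h η -
          (∫ x, h x ∂(SerialDependency.baseline π n) - SerialDependency.Xi₁ π h * √η +
            SerialDependency.Xi₂ π h * η))
        =O[𝓝[>] (0 : ℝ)] fun η : ℝ => η ^ (3 / 2 : ℝ)) := by
  exact ⟨SerialDependency.maxValue_expansion π h_meas h_bdd h_var,
    SerialDependency.minValue_expansion π h_meas h_bdd h_var⟩
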